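/- Let $a<b$ and $L>0$ be real numbers, let $\mathbb T$ be the circle obtained from $[a,b]$ by identifying the end points, and let $L_2(\mathbb T)$ be the complex Hilbert space with scalar product $\langle f,g\rangle=\frac1L\int_{\mathbb T} f\,\overline g\,dx$ and orthonormal Fourier basis $$b_k(x)=\sqrt{\tfrac{L}{b-a}}\;\exp\Bigl(2\pi i k\,\tfrac{x-a}{b-a}\Bigr),\qquad k\in\mathbb Z .$$ Let $d\in\mathbb N$, $d\ge 1$, and let $L_2(\mathbb T^d)$ carry the scalar product $\langle f,g\rangle=\frac1{L^d}\int_{\mathbb T^d} f\,\overline g\,dx$, with orthonormal basis $b_{\mathbf k}(x)=\prod_{j=1}^d b_{k_j}(x_j)$ and Fourier coefficients $\hat f(\mathbf k)=\langle f,b_{\mathbf k}\rangle$, $\mathbf k\in\mathbb Z^d$. For a nondecreasing sequence $1=w_0\le w_1\le w_2\le\dots$, extended by $w_{-k}=w_k$, let $H^w_{\rm mix}(\mathbb T^d)$ be the $d$-th Hilbert space tensor power of the space $H^w(\mathbb T)=\{f\in L_2(\mathbb T):\sum_{k\in\mathbb Z} w_k^2|\hat f(k)|^2<\infty\}$; that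 is, the Hilbert space of all $f\in L_2(\mathbb T^d)$ for which $$\|f\|_w^2=\sum_{\mathbf k\in\mathbb Z^d}\;\prod_{j=1}^d w_{k_j}^2\;|\hat f(\mathbf k)|^2$$ is finite. Let $s>0$ and $\gamma>0$, and write $H^{s,\square,\gamma}_{\rm mix}(\mathbb T^d)=H^w_{\rm mix}(\mathbb T^d)$ for the following choices of $w$, where $\eta_k=\bigl|\gamma^{-1}\frac{2\pi k}{b-a}\bigr|$: - $\square=\circ$ (only if $s$ is an integer): $w_k=\bigl(\sum_{l=0}^s \eta_k^{2l}\bigr)^{1/2}$; - $\square=*$: $w_k=\bigl(1+\eta_k^{2s}\bigr)^{1/2}$; - $\square=+$: $w_k=\bigl(1+\eta_k^{2}\bigr)^{s/2}$; - $\square=\#$: $w_k=\bigl(1+\eta_k\bigr)^{s}$. For a bounded linear operator $T:X\to Y$ between Hilbert spaces let $a_n(T)=\inf\{\|T-A\| : A\in\mathcal L(X,Y),\ \operatorname{rank}A<n\}$ be its $n$-th approximation number. Then for each $\square\in\{*,+,\#\}$, and also for $\square=\circ$ if $s$ is an integer, the limit below exists, and $$\lim_{n\to\infty} a_n\bigl(H^{s,\square,\gamma}_{\rm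 mix}(\mathbb T^d)\hookrightarrow L_2(\mathbb T^d)\bigr)\cdot n^s(\log n)^{-s(d-1)}=\left(\frac{\bigl(\gamma\,\frac{b-a}{\pi}\bigr)^d}{(d-1)!}\right)^{s}.$$ -/

import Mathlib

open MeasureTheory Filter Topology

noncomputable section

namespace TorusApprox

/-! ### Approximation numbers -/

/-- The `n`-th approximation number `a_n(T) = inf {‖T - A‖ : rank A < n}` of a bounded linear
operator, the infimum being over bounded linear operators `A`. (It is used for `n ≥ 1`.) -/
def approxNumber {X Y : Type*} [NormedAddCommGroup X] [NormedSpace ℂ X]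
    [NormedAddCommGroup Y] [NormedSpace ℂ Y] (T : X →L[ℂ] Y) (n : ℕ) : ℝ :=
  sInf {r : ℝ | ∃ A : X →L[ℂ] Y, (A : X →ₗ[ℂ] Y).rank < (n : Cardinal) ∧ r = ‖T - A‖}

/-! ### Weighted subspaces of a Hilbert space with a Hilbert basis -/

section Weighted

variable {ι E : Type*} [NormedAddCommGroup E] [InnerProductSpace ℂ E]

/-- The elements `f` of the Hilbert space `E` with `∑ₖ (W k)² |⟨b k, f⟩|² < ∞`. -/
def weightedSubmodule (b : HilbertBasis ι ℂ E) (W : ι → ℝ) : Submodule ℂ E where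
  carrier := {f | Summable fun k => W k ^ 2 * ‖b.repr f k‖ ^ 2}
  zero_mem' := by simp
  add_mem' := by
    intro f g hf hg
    refine Summable.of_nonneg_of_le (fun k => by positivity) (fun k => ?_)
      ((hf.add hg).mul_left 2)
    have h1 : ‖b.repr (f + g) k‖ ≤ ‖b.repr f k‖ + ‖b.repr g k‖ := by
      rw [map_add]; exact norm_add_le _ _
    have h2 : ‖b.repr (f + g) k‖ ^ 2 ≤ 2 * (‖b.repr f k‖ ^ 2 + ‖b.repr g k‖ ^ 2) := by
      nlinarith [sq_nonneg (‖b.repr f k‖ - ‖b.repr g k‖), norm_nonneg (b.repr (f + g) k)]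
    nlinarith [mul_le_mul_of_nonneg_left h2 (sq_nonneg (W k))]
  smul_mem' := by
    intro c f hf
    refine (hf.mul_left (‖c‖ ^ 2)).congr (fun k => ?_)
    rw [map_smul, lp.coeFn_smul, Pi.smul_apply, norm_smul]
    ring

/-- The space of all `f` in `E` with `∑ₖ (W k)² |⟨b k, f⟩|² < ∞`, as a Hilbert space of its own,
with the scalar product `∑ₖ conj (W k ⟨b k, f⟩) (W k ⟨b k, g⟩)`. -/
def WeightedSpace (b : HilbertBasis ι ℂ E) (W : ι → ℝ) (_hW : ∀ k, 1 ≤ W k) : Type _ :=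
  weightedSubmodule b W

namespace WeightedSpace

variable (b : HilbertBasis ι ℂ E) (W : ι → ℝ) (hW : ∀ k, 1 ≤ W k)

instance : AddCommGroup (WeightedSpace b W hW) :=
  inferInstanceAs (AddCommGroup (weightedSubmodule b W))

instance : Module ℂ (WeightedSpace b W hW) :=
  inferInstanceAs (Module ℂ (weightedSubmodule b W))

/-- The inclusion into `E`, as a linear map. -/
def incl : WeightedSpace b W hW →ₗ[ℂ] E := (weightedSubmodule b W).subtype

theorem incl_injective : Function.Injective (incl b W hW) :=
  (weightedSubmodule b W).injective_subtype

theorem incl_mem (f : WeightedSpace b W hW) :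
    Summable fun k => W k ^ 2 * ‖b.repr (incl b W hW f) k‖ ^ 2 := Subtype.property f

/-- The sequence `k ↦ W k * ⟨b k, f⟩` of weighted coefficients. -/
def coeffs : WeightedSpace b W hW →ₗ[ℂ] lp (fun _ : ι => ℂ) 2 where
  toFun f := ⟨fun k => (W k : ℂ) * b.repr (incl b W hW f) k, by
    refine memℓp_gen ((incl_mem b W hW f).congr fun k => ?_)
    rw [norm_mul, Complex.norm_real, ENNReal.toReal_ofNat, Real.rpow_ofNat, mul_pow,
      Real.norm_eq_abs, sq_abs]⟩
  map_add' f g := by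
    ext k
    change (W k : ℂ) * b.repr (incl b W hW (f + g)) k =
      (W k : ℂ) * b.repr (incl b W hW f) k + (W k : ℂ) * b.repr (incl b W hW g) k
    rw [map_add, map_add, lp.coeFn_add, Pi.add_apply, mul_add]
  map_smul' c f := by
    ext k
    change (W k : ℂ) * b.repr (incl b W hW (c • f)) k =
      c * ((W k : ℂ) * b.repr (incl b W hW f) k)
    rw [map_smul, map_smul, lp.coeFn_smul, Pi.smul_apply, smul_eq_mul]
    ring

theorem coeffs_apply (f : WeightedSpace b W hW) (k : ι) :
    coeffs b W hW f k = (W k : ℂ) * b.repr (incl b W hW f) k := rfl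

theorem coeffs_injective : Function.Injective (coeffs b W hW) := by
  intro f g h
  apply incl_injective b W hW
  apply b.repr.injective
  ext k
  have := congrArg (fun x : lp (fun _ : ι => ℂ) 2 => x k) h
  simp only [coeffs_apply] at this
  have h0 : (W k : ℂ) ≠ 0 := by exact_mod_cast (by linarith [hW k] : (0 : ℝ) < W k).ne'
  exact mul_left_cancel₀ h0 this

instance : NormedAddCommGroup (WeightedSpace b W hW) :=
  NormedAddCommGroup.induced _ _ (coeffs b W hW) (coeffs_injective b W hW)

theorem norm_eq (f : WeightedSpace b W hW) : ‖f‖ = ‖coeffs b W hW f‖ := rfl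

instance : InnerProductSpace ℂ (WeightedSpace b W hW) where
  inner f g := inner ℂ (coeffs b W hW f) (coeffs b W hW g)
  norm_smul_le c f := by
    rw [norm_eq, norm_eq, map_smul]; exact norm_smul_le _ _
  norm_sq_eq_re_inner f := by
    rw [norm_eq]; exact norm_sq_eq_re_inner (𝕜 := ℂ) _
  conj_inner_symm f g := inner_conj_symm _ _
  add_left f g h := by
    simp only [map_add, inner_add_left]
  smul_left f g c := by
    simp only [map_smul, inner_smul_left]

theorem inner_eq (f g : WeightedSpace b W hW) :
    inner ℂ f g = inner ℂ (coeffs b W hW f) (coeffs b W hW g) := rfl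

/-- The norm is the weighted `ℓ₂`-norm of the coefficients. -/
theorem norm_sq (f : WeightedSpace b W hW) :
    ‖f‖ ^ 2 = ∑' k, W k ^ 2 * ‖b.repr (incl b W hW f) k‖ ^ 2 := by
  have := lp.norm_rpow_eq_tsum (p := 2) (by norm_num) (coeffs b W hW f)
  simp only [ENNReal.toReal_ofNat, Real.rpow_ofNat] at this
  rw [norm_eq, this]
  refine tsum_congr fun k => ?_
  rw [coeffs_apply, norm_mul, Complex.norm_real, mul_pow, Real.norm_eq_abs, sq_abs]

theorem norm_incl_le (f : WeightedSpace b W hW) : ‖incl b W hW f‖ ≤ ‖f‖ := by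
  refine le_of_sq_le_sq ?_ (norm_nonneg _)
  rw [norm_sq, ← b.repr.norm_map]
  have := lp.norm_rpow_eq_tsum (p := 2) (by norm_num) (b.repr (incl b W hW f))
  simp only [ENNReal.toReal_ofNat, Real.rpow_ofNat] at this
  rw [this]
  refine Summable.tsum_le_tsum (fun k => ?_) ?_ (incl_mem b W hW f)
  · have : (1 : ℝ) ≤ W k ^ 2 := one_le_pow₀ (hW k)
    nlinarith [sq_nonneg ‖b.repr (incl b W hW f) k‖]
  · simpa using (lp.memℓp (b.repr (incl b W hW f))).summable (by norm_num)

/-- The embedding of the weighted space into `E`, as a bounded operator. -/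
def embedding : WeightedSpace b W hW →L[ℂ] E :=
  (incl b W hW).mkContinuous 1 fun f => by simpa using norm_incl_le b W hW f

theorem embedding_apply (f : WeightedSpace b W hW) : embedding b W hW f = incl b W hW f := rfl

theorem coeffs_surjective : Function.Surjective (coeffs b W hW) := by
  intro y
  have hy : Summable fun k => ‖y k‖ ^ 2 := by
    simpa using (lp.memℓp y).summable (by norm_num)
  have h0 : ∀ k, 0 < W k := fun k => by linarith [hW k]
  let z : lp (fun _ : ι => ℂ) 2 := ⟨fun k => y k / (W k : ℂ), by
    refine memℓp_gen (Summable.of_nonneg_of_le (fun k => by positivity) (fun k => ?_) hy)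
    rw [ENNReal.toReal_ofNat, Real.rpow_ofNat, norm_div, Complex.norm_real,
      Real.norm_of_nonneg (h0 k).le]
    exact pow_le_pow_left₀ (by have := (h0 k).le; positivity)
      (div_le_self (norm_nonneg _) (hW k)) 2⟩
  have hz : ∀ k, z k = y k / (W k : ℂ) := fun k => rfl
  have hm : b.repr.symm z ∈ weightedSubmodule b W := by
    refine hy.congr fun k => ?_
    rw [LinearIsometryEquiv.apply_symm_apply, hz, norm_div, Complex.norm_real,
      Real.norm_of_nonneg (h0 k).le]
    have := (h0 k).ne'
    field_simp
  obtain ⟨x, h2⟩ : ∃ x : WeightedSpace b W hW, incl b W hW x = b.repr.symm z := ⟨⟨_, hm⟩, rfl⟩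
  refine ⟨x, ?_⟩
  ext k
  have h1 : (W k : ℂ) ≠ 0 := by exact_mod_cast (h0 k).ne'
  rw [coeffs_apply, h2, LinearIsometryEquiv.apply_symm_apply, hz]
  field_simp

/-- Taking weighted coefficients is an isometric isomorphism onto `ℓ₂`. -/
def coeffsEquiv : WeightedSpace b W hW ≃ₗᵢ[ℂ] lp (fun _ : ι => ℂ) 2 :=
  { LinearEquiv.ofBijective (coeffs b W hW)
      ⟨coeffs_injective b W hW, coeffs_surjective b W hW⟩ with
    norm_map' := fun _ => rfl }

theorem inner_eq_tsum (f g : WeightedSpace b W hW) : inner ℂ f g =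
    ∑' k, coeffs b W hW g k * (starRingEnd ℂ) (coeffs b W hW f k) :=
  lp.inner_eq_tsum (coeffs b W hW f) (coeffs b W hW g)

theorem summable_inner (f g : WeightedSpace b W hW) :
    Summable fun k => ‖coeffs b W hW g k * (starRingEnd ℂ) (coeffs b W hW f k)‖ := by
  refine (lp.summable_inner (𝕜 := ℂ) (coeffs b W hW f) (coeffs b W hW g)).norm.congr fun k => ?_
  rw [RCLike.inner_apply]

theorem exists_coeffs_eq_single [DecidableEq ι] (k : ι) :
    ∃ f : WeightedSpace b W hW, ∀ l, coeffs b W hW f l = if l = k then 1 else 0 := by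
  obtain ⟨f, hf⟩ := coeffs_surjective b W hW (lp.single 2 k (1 : ℂ))
  exact ⟨f, fun l => by rw [hf, lp.single_apply, Pi.single_apply]⟩

theorem inner_eq_of_coeffs_eq_single [DecidableEq ι] (k : ι) (f g : WeightedSpace b W hW)
    (hf : ∀ l, coeffs b W hW f l = if l = k then 1 else 0) :
    inner ℂ f g = coeffs b W hW g k := by
  rw [inner_eq_tsum, tsum_eq_single k]
  · simp [hf]
  · intro l hl
    simp [hf, hl]

instance : CompleteSpace (WeightedSpace b W hW) :=
  (coeffsEquiv b W hW).toIsometryEquiv.completeSpace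

end WeightedSpace

end Weighted

/-! ### The torus and its Fourier basis -/

/-- The data of the one-dimensional torus: an interval `[a, b]`, whose end points are identified,
and the normalization constant `L` of the scalar product. -/
structure TorusData where
  /-- left end point -/
  a : ℝ
  /-- right end point -/
  b : ℝ
  /-- normalization constant -/
  L : ℝ
  a_lt_b : a < b
  L_pos : 0 < L

namespace TorusData

variable (T : TorusData)

instance : Fact (0 < T.b - T.a) := ⟨sub_pos.2 T.a_lt_b⟩

/-- The circle: the interval `[a, b]` with its end points identified. -/
abbrev Circle : Type := AddCircle (T.b - T.a)

/-- The measure `dx / L` on the circle, so that `⟨f, g⟩ = (1/L) ∫ f ḡ dx`. -/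
def circleMeasure : Measure T.Circle := (T.L⁻¹).toNNReal • volume

instance : IsFiniteMeasure T.circleMeasure := by
  unfold circleMeasure; infer_instance

/-- The `d`-dimensional torus. -/
abbrev Points (d : ℕ) : Type := Fin d → T.Circle

/-- The product measure `dx / L ^ d` on the `d`-dimensional torus. -/
def measure (d : ℕ) : Measure (T.Points d) := Measure.pi fun _ => T.circleMeasure

instance (d : ℕ) : IsFiniteMeasure (T.measure d) := by
  unfold measure; infer_instance

/-- The Hilbert space `L₂(𝕋)`, with `⟨f, g⟩ = (1/L) ∫ f ḡ dx`. -/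
abbrev L2Circle : Type := Lp ℂ 2 T.circleMeasure

/-- The Hilbert space `L₂(𝕋ᵈ)`. -/
abbrev L2 (d : ℕ) : Type := Lp ℂ 2 (T.measure d)

/-- The univariate functions `b_k(x) = √(L/(b-a)) exp(2πik (x-a)/(b-a))`. -/
def circleMonomial (k : ℤ) : C(T.Circle, ℂ) where
  toFun x := (Real.sqrt (T.L / (T.b - T.a)) : ℂ) * fourier k (x - (T.a : T.Circle))
  continuous_toFun := by fun_prop

theorem circleMonomial_apply (k : ℤ) (x : T.Circle) : T.circleMonomial k x =
    (Real.sqrt (T.L / (T.b - T.a)) : ℂ) * fourier k (x - (T.a : T.Circle)) := rfl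

theorem circleMonomial_coe (k : ℤ) (x : ℝ) : T.circleMonomial k (x : T.Circle) =
    (Real.sqrt (T.L / (T.b - T.a)) : ℂ) *
      Complex.exp (2 * Real.pi * Complex.I * k * ((x - T.a) / (T.b - T.a))) := by
  rw [circleMonomial_apply, ← AddCircle.coe_sub, fourier_coe_apply]
  congr 2
  push_cast
  ring

/-- The multivariate functions `b_k(x) = ∏ⱼ b_{k_j}(x_j)`. -/
def monomial {d : ℕ} (k : Fin d → ℤ) : C(T.Points d, ℂ) where
  toFun x := ∏ j, T.circleMonomial (k j) (x j)
  continuous_toFun := by fun_prop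

theorem monomial_apply {d : ℕ} (k : Fin d → ℤ) (x : T.Points d) :
    T.monomial k x = ∏ j, T.circleMonomial (k j) (x j) := rfl

theorem inner_circleMonomial (m n : ℤ) :
    ∫ x, T.circleMonomial n x * (starRingEnd ℂ) (T.circleMonomial m x) ∂T.circleMeasure =
      if m = n then 1 else 0 := by
  have h0 : 0 < T.b - T.a := Fact.out
  have hL := T.L_pos
  have h1 : ∀ x : T.Circle,
      T.circleMonomial n x * (starRingEnd ℂ) (T.circleMonomial m x) =
      ((T.L / (T.b - T.a) : ℝ) : ℂ) *
        (fun y : T.Circle => fourier n y * (starRingEnd ℂ) (fourier m y))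
          (x - (T.a : T.Circle)) := by
    intro x
    simp only [circleMonomial_apply, map_mul, Complex.conj_ofReal]
    rw [← Real.mul_self_sqrt (div_pos hL h0).le]
    push_cast
    rw [Real.mul_self_sqrt (div_pos hL h0).le]
    ring
  have h2 := (orthonormal_iff_ite.1 (orthonormal_fourier (T := T.b - T.a))) m n
  rw [ContinuousMap.inner_toLp, AddCircle.integral_haarAddCircle] at h2
  simp_rw [h1]
  rw [integral_const_mul, circleMeasure, integral_smul_nnreal_measure,
    integral_sub_right_eq_self
      (fun y : T.Circle => fourier n y * (starRingEnd ℂ) (fourier m y)), ← h2,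
    NNReal.smul_def, Real.coe_toNNReal _ (inv_pos.2 hL).le, Complex.real_smul,
    Complex.real_smul, ← mul_assoc]
  congr 1
  have : (T.L : ℂ) ≠ 0 := by exact_mod_cast hL.ne'
  push_cast
  field_simp

theorem inner_monomial {d : ℕ} (m n : Fin d → ℤ) :
    ∫ x, T.monomial n x * (starRingEnd ℂ) (T.monomial m x) ∂(T.measure d) =
      if m = n then 1 else 0 := by
  simp only [monomial_apply, map_prod, ← Finset.prod_mul_distrib]
  rw [measure, integral_fintype_prod_eq_prod
    (fun j x => T.circleMonomial (n j) x * (starRingEnd ℂ) (T.circleMonomial (m j) x))]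
  simp only [inner_circleMonomial]
  split_ifs with h
  · simp [h]
  · obtain ⟨j, hj⟩ := Function.ne_iff.1 h
    exact Finset.prod_eq_zero (Finset.mem_univ j) (if_neg hj)

end TorusData

section Density

theorem span_comp_dense {X Y κ : Type*} [TopologicalSpace X] [CompactSpace X]
    [TopologicalSpace Y] [CompactSpace Y] (e : Y ≃ₜ X) (g : κ → C(X, ℂ))
    (hg : (Submodule.span ℂ (Set.range g)).topologicalClosure = ⊤)
    (c : κ → ℂ) (hc : ∀ k, c k ≠ 0) (f : κ → C(Y, ℂ))
    (hf : ∀ k y, f k y = c k * g k (e y)) :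
    (Submodule.span ℂ (Set.range f)).topologicalClosure = ⊤ := by
  let φ : C(X, ℂ) →L[ℂ] C(Y, ℂ) :=
    ⟨(ContinuousMap.compRightAlgHom ℂ ℂ (e : C(Y, X))).toLinearMap,
      ContinuousMap.compRightAlgHom_continuous ℂ ℂ _⟩
  have hφ : ∀ u y, φ u y = u (e y) := fun u y => rfl
  have hs : Function.Surjective φ := fun u =>
    ⟨u.comp (e.symm : C(X, Y)), by ext y; simp [hφ]⟩
  have h1 := hs.denseRange.topologicalClosure_map_submodule hg
  refine top_unique (h1.ge.trans (Submodule.topologicalClosure_mono ?_))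
  rw [Submodule.map_span, Submodule.span_le]
  rintro _ ⟨_, ⟨k, rfl⟩, rfl⟩
  have : φ (g k) = (c k)⁻¹ • f k := by
    ext y
    rw [hφ, ContinuousMap.smul_apply, hf, smul_eq_mul, inv_mul_cancel_left₀ (hc k)]
  change φ (g k) ∈ _
  rw [this]
  exact Submodule.smul_mem _ _ (Submodule.subset_span ⟨k, rfl⟩)

theorem span_toLp_dense {X κ : Type*} [TopologicalSpace X] [CompactSpace X] [T4Space X]
    [MeasurableSpace X] [BorelSpace X] [SecondCountableTopologyEither X ℂ]
    (μ : Measure X) [IsFiniteMeasure μ] [μ.WeaklyRegular] (f : κ → C(X, ℂ))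
    (hf : (Submodule.span ℂ (Set.range f)).topologicalClosure = ⊤) :
    (Submodule.span ℂ (Set.range fun k => ContinuousMap.toLp (E := ℂ) 2 μ ℂ (f k))).topologicalClosure
      = ⊤ := by
  simpa only [Submodule.map_span, ContinuousLinearMap.coe_coe, ← Set.range_comp,
    Function.comp_def] using
    (ContinuousMap.toLp_denseRange ℂ μ ℂ (p := 2) (by simp)).topologicalClosure_map_submodule hf

end Density

namespace TorusData

variable (T : TorusData)

theorem sqrt_ne_zero : (Real.sqrt (T.L / (T.b - T.a)) : ℂ) ≠ 0 := by
  have h0 : 0 < T.b - T.a := Fact.out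
  exact_mod_cast (Real.sqrt_pos.2 (div_pos T.L_pos h0)).ne'

theorem span_circleMonomial :
    (Submodule.span ℂ (Set.range T.circleMonomial)).topologicalClosure = ⊤ :=
  span_comp_dense (Homeomorph.subRight (T.a : T.Circle)) fourier span_fourier_closure_eq_top
    (fun _ => (Real.sqrt (T.L / (T.b - T.a)) : ℂ)) (fun _ => T.sqrt_ne_zero) _
    (fun k y => T.circleMonomial_apply k y)

theorem fourier_homeomorph (k : ℤ) (x : T.Circle) :
    fourier k (AddCircle.homeomorphAddCircle (T.b - T.a) 1
      (Fact.out : 0 < T.b - T.a).ne' one_ne_zero x) = fourier k x := by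
  induction x using QuotientAddGroup.induction_on with
  | H x =>
    have h0 : ((T.b - T.a : ℝ) : ℂ) ≠ 0 := by
      exact_mod_cast (Fact.out : 0 < T.b - T.a).ne'
    change fourier k (AddCircle.homeomorphAddCircle (T.b - T.a) 1 _ _ ((x : ℝ) : T.Circle)) =
      fourier k ((x : ℝ) : T.Circle)
    rw [AddCircle.homeomorphAddCircle_apply_mk, fourier_coe_apply, fourier_coe_apply]
    congr 1
    push_cast at h0 ⊢
    field_simp

theorem span_monomial (d : ℕ) :
    (Submodule.span ℂ (Set.range (T.monomial (d := d)))).topologicalClosure = ⊤ := by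
  refine span_comp_dense
    (Homeomorph.piCongrRight fun _ : Fin d => (Homeomorph.subRight (T.a : T.Circle)).trans
      (AddCircle.homeomorphAddCircle (T.b - T.a) 1
        (Fact.out : 0 < T.b - T.a).ne' one_ne_zero))
    (UnitAddTorus.mFourier (d := Fin d)) UnitAddTorus.span_mFourier_closure_eq_top
    (fun _ => (Real.sqrt (T.L / (T.b - T.a)) : ℂ) ^ d)
    (fun _ => pow_ne_zero _ T.sqrt_ne_zero) _ (fun k y => ?_)
  rw [monomial_apply]
  simp only [circleMonomial_apply, Finset.prod_mul_distrib, Finset.prod_const,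
    Finset.card_univ, Fintype.card_fin]
  congr 1
  refine Finset.prod_congr rfl fun j _ => ?_
  exact (T.fourier_homeomorph (k j) (y j - (T.a : T.Circle))).symm

/-- The Fourier basis `(b_k)` of `L₂(𝕋)`. -/
def circleBasis : HilbertBasis ℤ ℂ T.L2Circle :=
  HilbertBasis.mk
    (v := fun k => ContinuousMap.toLp (E := ℂ) 2 T.circleMeasure ℂ (T.circleMonomial k))
    (orthonormal_iff_ite.2 fun m n => by
      rw [ContinuousMap.inner_toLp]; exact T.inner_circleMonomial m n)
    (span_toLp_dense _ _ T.span_circleMonomial).ge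

/-- The Fourier basis `(b_k)` of `L₂(𝕋ᵈ)`. -/
def basis (d : ℕ) : HilbertBasis (Fin d → ℤ) ℂ (T.L2 d) :=
  HilbertBasis.mk
    (v := fun k => ContinuousMap.toLp (E := ℂ) 2 (T.measure d) ℂ (T.monomial k))
    (orthonormal_iff_ite.2 fun m n => by
      rw [ContinuousMap.inner_toLp]; exact T.inner_monomial m n)
    (span_toLp_dense _ _ (T.span_monomial d)).ge

theorem circleBasis_apply (k : ℤ) : T.circleBasis k =
    ContinuousMap.toLp (E := ℂ) 2 T.circleMeasure ℂ (T.circleMonomial k) :=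
  congrFun (HilbertBasis.coe_mk _ _) k

theorem basis_apply {d : ℕ} (k : Fin d → ℤ) : T.basis d k =
    ContinuousMap.toLp (E := ℂ) 2 (T.measure d) ℂ (T.monomial k) :=
  congrFun (HilbertBasis.coe_mk _ _) k

/-- The Fourier coefficients are `f̂(k) = (1/L) ∫ f(x) conj(b_k(x)) dx`. -/
theorem circleBasis_repr (f : T.L2Circle) (k : ℤ) : T.circleBasis.repr f k =
    ∫ x, f x * (starRingEnd ℂ) (T.circleMonomial k x) ∂T.circleMeasure := by
  rw [HilbertBasis.repr_apply_apply, circleBasis_apply, L2.inner_def]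
  refine integral_congr_ae ?_
  filter_upwards [ContinuousMap.coeFn_toLp (p := 2) (𝕜 := ℂ) T.circleMeasure
    (T.circleMonomial k)] with x hx
  rw [hx, RCLike.inner_apply]

theorem basis_repr {d : ℕ} (f : T.L2 d) (k : Fin d → ℤ) : (T.basis d).repr f k =
    ∫ x, f x * (starRingEnd ℂ) (T.monomial k x) ∂(T.measure d) := by
  rw [HilbertBasis.repr_apply_apply, basis_apply, L2.inner_def]
  refine integral_congr_ae ?_
  filter_upwards [ContinuousMap.coeFn_toLp (p := 2) (𝕜 := ℂ) (T.measure d)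
    (T.monomial k)] with x hx
  rw [hx, RCLike.inner_apply]

end TorusData

/-! ### Univariate and mixed Sobolev spaces on the torus -/

/-- A nondecreasing sequence `w₀ = 1, w₁, w₂, …` of Fourier weights, extended to `ℤ` by
`w_{-k} = w_k`. -/
structure FourierWeight where
  /-- the weights `w_k`, `k ≥ 0` -/
  toFun : ℕ → ℝ
  monotone : Monotone toFun
  zero : toFun 0 = 1

namespace FourierWeight

/-- The weight `w_k` for `k ∈ ℤ`. -/
def val (w : FourierWeight) (k : ℤ) : ℝ := w.toFun k.natAbs

theorem one_le_val (w : FourierWeight) (k : ℤ) : 1 ≤ w.val k := by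
  rw [← w.zero]; exact w.monotone (Nat.zero_le _)

/-- The product weight `∏ⱼ w_{k_j}` for `k ∈ ℤᵈ`. -/
def prodVal (w : FourierWeight) {d : ℕ} (k : Fin d → ℤ) : ℝ := ∏ j, w.val (k j)

theorem one_le_prodVal (w : FourierWeight) {d : ℕ} (k : Fin d → ℤ) : 1 ≤ w.prodVal k :=
  calc (1 : ℝ) = ∏ _j : Fin d, (1 : ℝ) := by simp
    _ ≤ ∏ j, w.val (k j) :=
      Finset.prod_le_prod (fun _ _ => zero_le_one) fun j _ => w.one_le_val (k j)

end FourierWeight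

namespace TorusData

variable (T : TorusData)

/-- The univariate Sobolev space `H^w(𝕋)`: all `f ∈ L₂(𝕋)` with `∑ₖ w_k² |f̂(k)|² < ∞`. -/
abbrev Sobolev (w : FourierWeight) : Type :=
  WeightedSpace T.circleBasis w.val w.one_le_val

/-- The mixed order Sobolev space `H^w_mix(𝕋ᵈ)`, the `d`-th tensor power of `H^w(𝕋)`: all
`f ∈ L₂(𝕋ᵈ)` with `∑ₖ ∏ⱼ w_{k_j}² |f̂(k)|² < ∞`. That this is the tensor power is proved in
`isTensorPower_mixedSobolev` below. -/
abbrev MixedSobolev (d : ℕ) (w : FourierWeight) : Type :=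
  WeightedSpace (T.basis d) (w.prodVal (d := d)) w.one_le_prodVal

/-- The embedding of `H^w(𝕋)` into `L₂(𝕋)`. -/
def sobolevEmbedding (w : FourierWeight) : T.Sobolev w →L[ℂ] T.L2Circle :=
  WeightedSpace.embedding _ _ _

/-- The embedding of `H^w_mix(𝕋ᵈ)` into `L₂(𝕋ᵈ)`. -/
def mixedEmbedding (d : ℕ) (w : FourierWeight) : T.MixedSobolev d w →L[ℂ] T.L2 d :=
  WeightedSpace.embedding _ _ _

end TorusData

/-! ### The mixed space is the tensor power of the univariate space -/

section TensorPower

theorem hasSum_pi_prod : ∀ {d : ℕ} (F : Fin d → ℤ → ℂ), (∀ j, Summable fun k => ‖F j k‖) →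
    (Summable fun k : Fin d → ℤ => ‖∏ j, F j (k j)‖) ∧
      ∑' k : Fin d → ℤ, ∏ j, F j (k j) = ∏ j, ∑' k, F j k
  | 0, F, _ => by
    refine ⟨Summable.of_finite, ?_⟩
    simp [tsum_fintype]
  | d + 1, F, hF => by
    obtain ⟨h1, h2⟩ := hasSum_pi_prod (fun j : Fin d => F j.succ) fun j => hF j.succ
    have e : ∀ p : ℤ × (Fin d → ℤ), ∏ j, F j (Fin.consEquiv (fun _ => ℤ) p j) =
        F 0 p.1 * ∏ j : Fin d, F j.succ (p.2 j) := by
      intro p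
      simp [Fin.prod_univ_succ, Fin.consEquiv]
    constructor
    · rw [← (Fin.consEquiv fun _ : Fin (d + 1) => ℤ).summable_iff]
      refine ((hF 0).mul_norm h1).congr fun p => ?_
      rw [Function.comp_apply, e]
    · rw [← (Fin.consEquiv fun _ : Fin (d + 1) => ℤ).tsum_eq, Fin.prod_univ_succ, ← h2,
        tsum_mul_tsum_of_summable_norm (hF 0) h1]
      exact tsum_congr e

namespace TorusData

variable (T : TorusData)

theorem memLp_tensor {d : ℕ} (f : Fin d → T.L2Circle) :
    MemLp (fun x : T.Points d => ∏ j, f j (x j)) 2 (T.measure d) := by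
  rw [memLp_two_iff_integrable_sq_norm]
  · simp only [norm_prod, ← Finset.prod_pow]
    exact Integrable.fintype_prod (f := fun j x => ‖f j x‖ ^ 2) fun j =>
      (memLp_two_iff_integrable_sq_norm (Lp.aestronglyMeasurable (f j))).1 (Lp.memLp (f j))
  · refine Finset.aestronglyMeasurable_fun_prod _ fun j _ => ?_
    exact (Lp.aestronglyMeasurable (f j)).comp_quasiMeasurePreserving
      (Measure.quasiMeasurePreserving_eval (fun _ => T.circleMeasure) j)

/-- The tensor product `(f₁ ⊗ ⋯ ⊗ f_d)(x) = f₁(x₁) ⋯ f_d(x_d)` of univariate `L₂`-functions. -/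
def tensorL2 {d : ℕ} (f : Fin d → T.L2Circle) : T.L2 d := (T.memLp_tensor f).toLp _

theorem basis_repr_tensorL2 {d : ℕ} (f : Fin d → T.L2Circle) (k : Fin d → ℤ) :
    (T.basis d).repr (T.tensorL2 f) k = ∏ j, T.circleBasis.repr (f j) (k j) := by
  simp only [basis_repr, circleBasis_repr]
  rw [← integral_fintype_prod_eq_prod
    (fun j x => f j x * (starRingEnd ℂ) (T.circleMonomial (k j) x))]
  refine integral_congr_ae ?_
  filter_upwards [(T.memLp_tensor f).coeFn_toLp] with x hx
  rw [tensorL2, hx, monomial_apply, map_prod, Finset.prod_mul_distrib]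

/-- `H^w_mix(𝕋ᵈ)` is the `d`-th tensor power of `H^w(𝕋)`: it contains all the tensor products of
functions from `H^w(𝕋)`, their scalar products are the products of the univariate scalar products,
and their linear span is dense. -/
theorem isTensorPower_mixedSobolev (d : ℕ) (w : FourierWeight) :
    ∃ t : (Fin d → T.Sobolev w) → T.MixedSobolev d w,
      (∀ f, T.mixedEmbedding d w (t f) = T.tensorL2 fun j => T.sobolevEmbedding w (f j)) ∧
      (∀ f g, inner ℂ (t f) (t g) = ∏ j, inner ℂ (f j) (g j)) ∧
      (Submodule.span ℂ (Set.range t)).topologicalClosure = ⊤ := by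
  have hmem : ∀ f : Fin d → T.Sobolev w,
      (T.tensorL2 fun j => T.sobolevEmbedding w (f j)) ∈
        weightedSubmodule (T.basis d) (w.prodVal (d := d)) := by
    intro f
    have := (hasSum_pi_prod (fun j k => ((w.val k ^ 2 *
      ‖T.circleBasis.repr (T.sobolevEmbedding w (f j)) k‖ ^ 2 : ℝ) : ℂ)) fun j => by
        refine (WeightedSpace.incl_mem _ _ _ (f j)).congr fun k => ?_
        rw [Complex.norm_real, Real.norm_of_nonneg (by positivity)]
        rfl).1
    refine this.congr fun k => ?_
    rw [basis_repr_tensorL2, FourierWeight.prodVal, norm_prod, norm_prod, ← Finset.prod_pow,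
      ← Finset.prod_pow, ← Finset.prod_mul_distrib]
    refine Finset.prod_congr rfl fun j _ => ?_
    rw [Complex.norm_real, Real.norm_of_nonneg (by positivity)]
  choose t ht using fun f => show ∃ x : T.MixedSobolev d w,
    T.mixedEmbedding d w x = T.tensorL2 fun j => T.sobolevEmbedding w (f j) from ⟨⟨_, hmem f⟩, rfl⟩
  let c (f : T.Sobolev w) (k : ℤ) : ℂ :=
    WeightedSpace.coeffs T.circleBasis w.val w.one_le_val f k
  have hc : ∀ f k, WeightedSpace.coeffs (T.basis d) w.prodVal w.one_le_prodVal (t f) k =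
      ∏ j, c (f j) (k j) := by
    intro f k
    have h1 := ht f
    rw [mixedEmbedding, WeightedSpace.embedding_apply] at h1
    rw [WeightedSpace.coeffs_apply, h1, basis_repr_tensorL2, FourierWeight.prodVal,
      Complex.ofReal_prod, ← Finset.prod_mul_distrib]
    rfl
  refine ⟨t, ht, fun f g => ?_, ?_⟩
  · have h1 : ∀ j, inner ℂ (f j) (g j) = ∑' k, c (g j) k * (starRingEnd ℂ) (c (f j) k) :=
      fun j => WeightedSpace.inner_eq_tsum _ _ _ (f j) (g j)
    rw [WeightedSpace.inner_eq_tsum, Finset.prod_congr rfl fun j _ => h1 j,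
      ← (hasSum_pi_prod (fun j k => c (g j) k * (starRingEnd ℂ) (c (f j) k))
        fun j => WeightedSpace.summable_inner _ _ _ (f j) (g j)).2]
    refine tsum_congr fun k => ?_
    rw [hc, hc, map_prod, Finset.prod_mul_distrib]
  · rw [Submodule.topologicalClosure_eq_top_iff, Submodule.eq_bot_iff]
    intro x hx
    rw [Submodule.mem_orthogonal] at hx
    apply WeightedSpace.coeffs_injective
    rw [map_zero]
    ext k
    choose u hu using fun j => WeightedSpace.exists_coeffs_eq_single T.circleBasis w.val
      w.one_le_val (k j)
    have h1 := hx (t u) (Submodule.subset_span ⟨u, rfl⟩)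
    have h2 : ∀ l, WeightedSpace.coeffs (T.basis d) w.prodVal w.one_le_prodVal (t u) l =
        if l = k then 1 else 0 := by
      intro l
      rw [hc]
      split_ifs with h
      · subst h
        exact Finset.prod_eq_one fun j _ => (hu j (l j)).trans (if_pos rfl)
      · obtain ⟨j, hj⟩ := Function.ne_iff.1 h
        exact Finset.prod_eq_zero (Finset.mem_univ j) ((hu j (l j)).trans (if_neg hj))
    rw [WeightedSpace.inner_eq_of_coeffs_eq_single _ _ _ k _ _ h2] at h1
    exact h1

end TorusData

end TensorPower

/-! ### The four families of weights -/

namespace TorusData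

variable (T : TorusData)

/-- The scaled frequency `|γ⁻¹ 2πk/(b-a)|`. -/
def freq (γ : ℝ) (k : ℕ) : ℝ := |γ⁻¹ * (2 * Real.pi * k / (T.b - T.a))|

theorem freq_nonneg (γ : ℝ) (k : ℕ) : 0 ≤ T.freq γ k := abs_nonneg _

theorem freq_zero (γ : ℝ) : T.freq γ 0 = 0 := by simp [freq]

theorem freq_mono (γ : ℝ) : Monotone (T.freq γ) := by
  intro k l h
  have e : ∀ m : ℕ, T.freq γ m = |γ⁻¹ * (2 * Real.pi / (T.b - T.a))| * m := by
    intro m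
    rw [freq, ← abs_of_nonneg (Nat.cast_nonneg (α := ℝ) m), ← abs_mul,
      abs_of_nonneg (Nat.cast_nonneg (α := ℝ) m)]
    congr 1
    ring
  rw [e, e]
  gcongr

/-- The weight of `H^{s,∘,γ}_mix`: `w_k = (∑_{l=0}^s |γ⁻¹ 2πk/(b-a)|^{2l})^{1/2}`, `s ∈ ℕ`. -/
def circWeight (s : ℕ) (γ : ℝ) : FourierWeight where
  toFun k := (∑ l ∈ Finset.range (s + 1), T.freq γ k ^ (2 * l)) ^ (1 / 2 : ℝ)
  monotone k l h := by
    have := T.freq_nonneg γ k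
    have := T.freq_mono γ h
    dsimp only
    gcongr
  zero := by simp [freq_zero, Finset.sum_range_succ']

/-- The weight of `H^{s,*,γ}_mix`: `w_k = (1 + |γ⁻¹ 2πk/(b-a)|^{2s})^{1/2}`. -/
def starWeight (s : ℝ) (hs : 0 < s) (γ : ℝ) : FourierWeight where
  toFun k := (1 + T.freq γ k ^ (2 * s)) ^ (1 / 2 : ℝ)
  monotone k l h := by
    have := T.freq_nonneg γ k
    have := T.freq_mono γ h
    dsimp only
    gcongr
  zero := by simp [freq_zero, hs.ne']

/-- The weight of `H^{s,+,γ}_mix`: `w_k = (1 + |γ⁻¹ 2πk/(b-a)|²)^{s/2}`. -/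
def plusWeight (s : ℝ) (hs : 0 < s) (γ : ℝ) : FourierWeight where
  toFun k := (1 + T.freq γ k ^ 2) ^ (s / 2)
  monotone k l h := by
    have := T.freq_nonneg γ k
    have := T.freq_mono γ h
    dsimp only
    gcongr
  zero := by simp [freq_zero]

/-- The weight of `H^{s,#,γ}_mix`: `w_k = (1 + |γ⁻¹ 2πk/(b-a)|)^s`. -/
def sharpWeight (s : ℝ) (hs : 0 < s) (γ : ℝ) : FourierWeight where
  toFun k := (1 + T.freq γ k) ^ s
  monotone k l h := by
    have := T.freq_nonneg γ k
    have := T.freq_mono γ h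
    dsimp only
    gcongr
  zero := by simp [freq_zero]

end TorusData

end TorusApprox

end

open Asymptotics

namespace TorusApprox

/-! ### Approximation numbers of a diagonal embedding -/

section ApproxNumbers

universe u v

variable {ι : Type u} {E : Type v} [NormedAddCommGroup E] [InnerProductSpace ℂ E]

/-! With respect to orthonormal bases the embedding is diagonal with entries `1 / W k`, so its
approximation numbers are governed by how many `k` satisfy `W k ≤ R`. Truncation to such a set gives
the upper bound (`approxNumber_embedding_le`), and a dimension count on its span gives the lower
bound (`le_approxNumber_embedding`). The theorem thus becomes a lattice point count in a weighted
hyperbolic cross.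

Put `u k = w_k ^ (1 / s)`. All four weights satisfy `u k ~ c k` with `c = 2π / (γ (b - a))`, and
nothing else about them matters. Let `N_d(r)` be the number of `k ∈ ℤᵈ` with `∏ u |k_j| ≤ r`. Fixing
one coordinate gives `N_{d+1}(r) = 2 ∑_{u k ≤ r} N_d(r / u k) - N_d(r)`. If `N_d(x) ~ A x (log
x)^(d-1)`, the sum is asymptotically `A r ∑ (log (r / u k))^(d-1) / u k ~ A r (log r)^d / (c d)`,
and the subtracted term is smaller by a factor `log r`. By induction `N_d(r) ~ ((2 / c)^d / (d-1)!)
r (log r)^(d-1)` (`tendsto_latticeCount`); the inner sum is handled by `tendsto_sum_log_div_pow`.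

To invert, put `r = t n / (log n)^(d-1)`. Then `log r ~ log n`, so `N_d(r) / n` tends to `t (2 /
c)^d / (d-1)!` (`tendsto_latticeCount_comp`). Choosing `t` so that this limit is just below or just
above `1` encloses `a_n` between two bounds that differ by a factor arbitrarily close to `1`. -/

theorem norm_sq_eq_tsum_repr (b : HilbertBasis ι ℂ E) (f : E) :
    ‖f‖ ^ 2 = ∑' k, ‖b.repr f k‖ ^ 2 := by
  have := lp.norm_rpow_eq_tsum (p := 2) (by norm_num) (b.repr f)
  simpa only [ENNReal.toReal_ofNat, Real.rpow_ofNat, b.repr.norm_map] using this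

theorem summable_repr_sq (b : HilbertBasis ι ℂ E) (f : E) :
    Summable fun k => ‖b.repr f k‖ ^ 2 := by
  simpa using (lp.memℓp (b.repr f)).summable (by norm_num)

variable (b : HilbertBasis ι ℂ E) (W : ι → ℝ) (hW : ∀ k, 1 ≤ W k)

/-- The competitor is the truncation of the expansion to `F`, of rank at most `F.card`. In the
remainder each coefficient is at most `R⁻¹` times its weighted version. -/
theorem approxNumber_embedding_le {F : Finset ι} {R : ℝ} (hR : 0 < R) (hF : ∀ k ∉ F, R ≤ W k)
    {n : ℕ} (hn : F.card < n) :
    approxNumber (WeightedSpace.embedding b W hW) n ≤ R⁻¹ := by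
  classical
  let A : WeightedSpace b W hW →L[ℂ] E :=
    ∑ k ∈ F, ((innerSL ℂ (b k)).comp (WeightedSpace.embedding b W hW)).smulRight (b k)
  have hA : ∀ f, A f = ∑ k ∈ F, b.repr (WeightedSpace.incl b W hW f) k • b k := by
    intro f
    simp [A, b.repr_apply_apply, WeightedSpace.embedding_apply]
  have hrank : (A : WeightedSpace b W hW →ₗ[ℂ] E).rank < (n : Cardinal) := by
    have h1 : LinearMap.range (A : WeightedSpace b W hW →ₗ[ℂ] E) ≤
        Submodule.span ℂ (F.image b : Set E) := by
      rintro _ ⟨f, rfl⟩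
      change A f ∈ _
      rw [hA]
      exact Submodule.sum_mem _ fun k hk => Submodule.smul_mem _ _
        (Submodule.subset_span (by exact_mod_cast Finset.mem_image_of_mem b hk))
    calc (A : WeightedSpace b W hW →ₗ[ℂ] E).rank
        ≤ Module.rank ℂ (Submodule.span ℂ (F.image b : Set E)) := Submodule.rank_mono h1
      _ ≤ ((F.image b).card : Cardinal) := rank_span_finset_le _
      _ ≤ (F.card : Cardinal) := by exact_mod_cast Finset.card_image_le
      _ < n := by exact_mod_cast hn
  have hrepr : ∀ f k, b.repr ((WeightedSpace.embedding b W hW - A) f) k =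
      if k ∈ F then 0 else b.repr (WeightedSpace.incl b W hW f) k := by
    intro f k
    have h2 : b.repr (A f) k = if k ∈ F then b.repr (WeightedSpace.incl b W hW f) k else 0 := by
      rw [hA, b.repr_apply_apply, inner_sum]
      simp only [inner_smul_right, orthonormal_iff_ite.1 b.orthonormal]
      simp
    rw [_root_.sub_apply, map_sub, lp.coeFn_sub, Pi.sub_apply, h2,
      WeightedSpace.embedding_apply]
    split_ifs <;> simp
  have hnorm : ‖WeightedSpace.embedding b W hW - A‖ ≤ R⁻¹ := by
    refine ContinuousLinearMap.opNorm_le_bound _ (by positivity) fun f => ?_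
    refine le_of_sq_le_sq ?_ (by positivity)
    rw [norm_sq_eq_tsum_repr b, mul_pow, WeightedSpace.norm_sq, ← tsum_mul_left]
    refine Summable.tsum_le_tsum (fun k => ?_) (summable_repr_sq b _)
      ((WeightedSpace.incl_mem b W hW f).mul_left _)
    rw [hrepr]
    split_ifs with hk
    · rw [norm_zero, zero_pow two_ne_zero]; positivity
    · have h3 : 1 ≤ R⁻¹ * W k := by
        rw [inv_mul_eq_div, one_le_div hR]; exact hF k hk
      have h4 : 1 ≤ (R⁻¹ * W k) ^ 2 := one_le_pow₀ h3
      nlinarith [sq_nonneg ‖b.repr (WeightedSpace.incl b W hW f) k‖]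
  refine le_trans (csInf_le ⟨0, ?_⟩ (Set.mem_ofPred.2 ⟨A, hrank, rfl⟩)) hnorm
  rintro _ ⟨B, -, rfl⟩
  exact norm_nonneg _

/-- An operator of rank less than `n ≤ F.card` kills some nonzero `x` with coefficients supported in
`F`. On such `x` the weighted norm is at most `R` times the norm in `E`, so the error on `x` is at
least `R⁻¹ * ‖x‖`. -/
theorem le_approxNumber_embedding {F : Finset ι} {R : ℝ} (hR : 0 < R) (hF : ∀ k ∈ F, W k ≤ R)
    {n : ℕ} (hn0 : 0 < n) (hn : n ≤ F.card) :
    R⁻¹ ≤ approxNumber (WeightedSpace.embedding b W hW) n := by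
  classical
  -- Positivity of `n` makes the zero operator admissible; for `n = 0` the infimum is over the empty
  -- set.
  refine le_csInf ⟨_, 0, by simpa using hn0, rfl⟩ ?_
  rintro _ ⟨A, hA, rfl⟩
  choose e he using WeightedSpace.exists_coeffs_eq_single b W hW
  let Λ : (F → ℂ) →ₗ[ℂ] WeightedSpace b W hW :=
    Fintype.linearCombination ℂ (fun k : F => e k)
  have hΛ : ∀ c l, WeightedSpace.coeffs b W hW (Λ c) l = ∑ k : F, if l = k then c k else 0 := by
    intro c l
    rw [Fintype.linearCombination_apply, map_sum, lp.coeFn_sum, Finset.sum_apply]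
    refine Finset.sum_congr rfl fun k _ => ?_
    rw [map_smul, lp.coeFn_smul, Pi.smul_apply, he]
    simp
  have hker : ∃ c : F → ℂ, c ≠ 0 ∧ A (Λ c) = 0 := by
    by_contra! h
    have hinj : Function.Injective ((A : WeightedSpace b W hW →ₗ[ℂ] E) ∘ₗ Λ) := by
      rw [injective_iff_map_eq_zero]
      intro c hc
      by_contra h0
      exact h c h0 hc
    -- `F → ℂ` and the range of `A` live in different universes, so the dimensions are compared
    -- after lifting.
    have h1 := LinearMap.lift_rank_le_of_injective
      (((A : WeightedSpace b W hW →ₗ[ℂ] E) ∘ₗ Λ).codRestrict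
        (LinearMap.range (A : WeightedSpace b W hW →ₗ[ℂ] E)) fun c => ⟨Λ c, rfl⟩)
      (fun x y hxy => hinj (congrArg Subtype.val hxy))
    have h2 : Module.rank ℂ (F → ℂ) = (F.card : Cardinal) := by
      rw [rank_fun']; simp
    rw [h2, Cardinal.lift_natCast] at h1
    have h3 : Cardinal.lift.{u} (A : WeightedSpace b W hW →ₗ[ℂ] E).rank < (n : Cardinal) := by
      rw [← Cardinal.lift_natCast.{u, v}, Cardinal.lift_lt]; exact hA
    have h4 := h1.trans_lt h3
    rw [Nat.cast_lt] at h4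
    omega
  obtain ⟨c, hc, hAc⟩ := hker
  set x := Λ c with hx
  have hx0 : x ≠ 0 := by
    intro h0
    apply hc
    ext k
    have := hΛ c k
    rw [← hx, h0, map_zero] at this
    simpa [Subtype.coe_inj] using this.symm
  have hle : ‖x‖ ≤ R * ‖WeightedSpace.incl b W hW x‖ := by
    refine le_of_sq_le_sq ?_ (by positivity)
    rw [mul_pow, norm_sq_eq_tsum_repr b, WeightedSpace.norm_sq, ← tsum_mul_left]
    refine Summable.tsum_le_tsum (fun k => ?_) (WeightedSpace.incl_mem b W hW x)
      ((summable_repr_sq b _).mul_left _)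
    by_cases hk : k ∈ F
    · have := hF k hk
      have := hW k
      gcongr
    · have h1 : WeightedSpace.coeffs b W hW x k = 0 := by
        rw [hΛ]
        refine Finset.sum_eq_zero fun l _ => if_neg ?_
        rintro rfl
        exact hk l.2
      rw [WeightedSpace.coeffs_apply] at h1
      have h0 : (W k : ℂ) ≠ 0 := by exact_mod_cast (by linarith [hW k] : (0 : ℝ) < W k).ne'
      have h2 := (mul_eq_zero.1 h1).resolve_left h0
      rw [h2]; simp
  have hop := (WeightedSpace.embedding b W hW - A).le_opNorm x
  rw [_root_.sub_apply, hAc, sub_zero, WeightedSpace.embedding_apply] at hop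
  have hxpos : 0 < ‖x‖ := norm_pos_iff.2 hx0
  rw [inv_le_iff_one_le_mul₀' hR]
  refine le_of_mul_le_mul_right ?_ hxpos
  calc 1 * ‖x‖ ≤ R * ‖WeightedSpace.incl b W hW x‖ := by rw [one_mul]; exact hle
    _ ≤ R * (‖WeightedSpace.embedding b W hW - A‖ * ‖x‖) := by gcongr
    _ = _ := by ring

end ApproxNumbers

/-! ### Logarithmic sums along a sequence of linear growth -/

section LogSums

theorem tendsto_log_natCast : Tendsto (fun k : ℕ => Real.log k) atTop atTop :=
  Real.tendsto_log_atTop.comp tendsto_natCast_atTop_atTop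

/-- `log f ~ log g` if `f / g` tends to a positive limit and `g → ∞`. -/
theorem tendsto_log_div_log {α : Type*} {l : Filter α} {f g : α → ℝ} {c : ℝ} (hc : 0 < c)
    (h : Tendsto (fun x => f x / g x) l (𝓝 c)) (hg : Tendsto g l atTop) :
    Tendsto (fun x => Real.log (f x) / Real.log (g x)) l (𝓝 1) := by
  have hlg := Real.tendsto_log_atTop.comp hg
  have h1 := ((h.log hc.ne').div_atTop hlg).add_const 1
  rw [zero_add] at h1
  refine h1.congr' ?_
  filter_upwards [hg.eventually_gt_atTop 0, hlg.eventually_gt_atTop 0,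
    h.eventually_const_lt hc] with x hx hx' hq
  have hf : f x ≠ 0 := by
    rintro h0
    simp [h0] at hq
  simp only [Function.comp_apply] at hx' ⊢
  rw [Real.log_div hf hx.ne']
  field_simp
  ring

/-- Factor `x^(j+1) - y^(j+1) = (∑ x^i y^(j-i)) (x - y)` with `x = log (k+1)`, `y = log k`: here `k
(x - y) → 1` and `x / y → 1`. These differences telescope, which makes them the comparison sequence
for the sums below. -/
theorem tendsto_log_succ_pow_sub (j : ℕ) :
    Tendsto (fun k : ℕ => (Real.log ((k + 1 : ℕ) : ℝ) ^ (j + 1) - Real.log (k : ℝ) ^ (j + 1)) * k /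
      Real.log k ^ j) atTop (𝓝 (j + 1)) := by
  have h1 : Tendsto (fun k : ℕ => (k : ℝ) * (Real.log ((k + 1 : ℕ) : ℝ) - Real.log k)) atTop (𝓝 1) := by
    refine ((Real.tendsto_mul_log_one_add_div_atTop 1).comp
      tendsto_natCast_atTop_atTop).congr' ?_
    filter_upwards [eventually_gt_atTop 0] with k hk
    have hk' : (0 : ℝ) < k := by exact_mod_cast hk
    rw [Function.comp_apply, ← Real.log_div (by positivity) hk'.ne']
    congr 2
    push_cast
    field_simp
  have h2 : Tendsto (fun k : ℕ => Real.log ((k + 1 : ℕ) : ℝ) / Real.log k) atTop (𝓝 1) := by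
    refine tendsto_log_div_log one_pos ?_ tendsto_natCast_atTop_atTop
    have := (tendsto_inv_atTop_nhds_zero_nat (𝕜 := ℝ)).const_add 1
    rw [add_zero] at this
    refine this.congr' ?_
    filter_upwards [eventually_gt_atTop 0] with k hk
    have hk' : (0 : ℝ) < k := by exact_mod_cast hk
    push_cast
    field_simp
  have h3 : Tendsto (fun k : ℕ => ∑ i ∈ Finset.range (j + 1),
      (Real.log ((k + 1 : ℕ) : ℝ) / Real.log k) ^ i) atTop (𝓝 (j + 1)) := by
    have := tendsto_finsetSum (Finset.range (j + 1)) fun i _ => h2.pow i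
    simpa using this
  have h4 := h1.mul h3
  rw [one_mul] at h4
  refine h4.congr' ?_
  filter_upwards [tendsto_log_natCast.eventually_gt_atTop 0] with k hk
  rw [← geom_sum₂_mul, eq_div_iff (by positivity)]
  have h5 : ∑ i ∈ Finset.range (j + 1),
      Real.log ((k + 1 : ℕ) : ℝ) ^ i * Real.log k ^ (j + 1 - 1 - i) =
      (∑ i ∈ Finset.range (j + 1), (Real.log ((k + 1 : ℕ) : ℝ) / Real.log k) ^ i) *
        Real.log k ^ j := by
    rw [Finset.sum_mul]
    refine Finset.sum_congr rfl fun i hi => ?_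
    have hi' : i ≤ j := Nat.lt_succ_iff.1 (Finset.mem_range.1 hi)
    rw [div_pow, div_mul_eq_mul_div, eq_div_iff (by positivity), mul_assoc, ← pow_add]
    congr 2
    omega
  rw [h5]
  ring

/-- A discrete form of `∫ (log x)^j / (c x) dx`: the summand is asymptotic to `c⁻¹ / (j + 1)` times
the telescoping difference `g`. Since `g ≥ 0` has divergent sum, a termwise error `o(g)` stays
negligible after summation. -/
theorem tendsto_sum_log_pow_div {u : ℕ → ℝ} {c : ℝ} (hc : 0 < c)
    (hu : Tendsto (fun k : ℕ => u k / k) atTop (𝓝 c)) (j : ℕ) :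
    Tendsto (fun n : ℕ => (∑ k ∈ Finset.range n, Real.log (u k) ^ j / u k) /
      Real.log n ^ (j + 1)) atTop (𝓝 (c⁻¹ / (j + 1))) := by
  let g : ℕ → ℝ := fun k => Real.log ((k + 1 : ℕ) : ℝ) ^ (j + 1) - Real.log (k : ℝ) ^ (j + 1)
  have hg0 : 0 ≤ g := by
    intro k
    refine sub_nonneg.2 (pow_le_pow_left₀ (Real.log_natCast_nonneg k) ?_ _)
    rcases Nat.eq_zero_or_pos k with rfl | hk
    · simp
    · exact Real.log_le_log (by exact_mod_cast hk) (by push_cast; linarith)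
  have hgs : ∀ n, ∑ k ∈ Finset.range n, g k = Real.log n ^ (j + 1) := by
    intro n
    rw [Finset.sum_range_sub (fun k : ℕ => Real.log (k : ℝ) ^ (j + 1))]
    simp
  have hgt : Tendsto (fun n => ∑ k ∈ Finset.range n, g k) atTop atTop := by
    simp_rw [hgs]
    exact (tendsto_pow_atTop (Nat.succ_ne_zero j)).comp tendsto_log_natCast
  have hratio : Tendsto (fun k => (Real.log (u k) ^ j / u k) / g k) atTop
      (𝓝 (c⁻¹ / (j + 1))) := by
    have h1 := (tendsto_log_div_log hc hu tendsto_natCast_atTop_atTop).pow j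
    have h2 := hu.inv₀ hc.ne'
    have h3 := (h1.mul h2).div (tendsto_log_succ_pow_sub j) (by positivity)
    rw [one_pow, one_mul] at h3
    refine h3.congr' ?_
    filter_upwards [tendsto_log_natCast.eventually_gt_atTop 0, eventually_gt_atTop 0] with k hk hk0
    have hk' : (0 : ℝ) < k := by exact_mod_cast hk0
    simp only [g]
    -- Where `u k` or the difference vanishes, both sides are `0` by the convention for division by
    -- zero.
    rcases eq_or_ne (u k) 0 with h0 | h0
    · simp [h0]
    rw [Pi.div_apply]
    generalize Real.log ((k + 1 : ℕ) : ℝ) ^ (j + 1) - Real.log (k : ℝ) ^ (j + 1) = D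
    rcases eq_or_ne D 0 with rfl | h0'
    · simp
    · have := hk.ne'
      rw [div_pow]
      field_simp
  have hgne : ∀ᶠ k in atTop, g k ≠ 0 := by
    filter_upwards [(tendsto_log_succ_pow_sub j).eventually_const_lt (by positivity :
      (0 : ℝ) < (j : ℝ) + 1)] with k hk h0
    change 0 < g k * k / Real.log k ^ j at hk
    simp [h0] at hk
  have hlittle : (fun k => Real.log (u k) ^ j / u k - c⁻¹ / (j + 1) * g k) =o[atTop] g := by
    rw [isLittleO_iff_tendsto' (hgne.mono fun k hk h0 => absurd h0 hk)]
    have h1 := hratio.sub_const (c⁻¹ / (j + 1))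
    rw [sub_self] at h1
    refine h1.congr' ?_
    filter_upwards [hgne] with k hk
    rw [sub_div, mul_div_cancel_right₀ _ hk]
  have hsum := (hlittle.sum_range hg0 hgt).tendsto_div_nhds_zero.add_const (c⁻¹ / (j + 1))
  rw [zero_add] at hsum
  refine hsum.congr' ?_
  filter_upwards [hgt.eventually_gt_atTop 0] with n hn
  rw [Finset.sum_sub_distrib, ← Finset.mul_sum, sub_div, mul_div_cancel_right₀ _ hn.ne', hgs]
  ring

end LogSums

/-! ### Level counts and sums over a level set -/

section Counting

/-- The number of `k : ℕ` with `u k ≤ r`. -/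
noncomputable def levelCount (u : ℕ → ℝ) (r : ℝ) : ℕ := Nat.card {k : ℕ | u k ≤ r}

variable {u : ℕ → ℝ} {c : ℝ}

theorem tendsto_atTop_of_div (hc : 0 < c) (hu : Tendsto (fun k : ℕ => u k / k) atTop (𝓝 c)) :
    Tendsto u atTop atTop := by
  refine (hu.pos_mul_atTop hc tendsto_natCast_atTop_atTop).congr' ?_
  filter_upwards [eventually_gt_atTop 0] with k hk
  have hk' : (k : ℝ) ≠ 0 := by exact_mod_cast hk.ne'
  field_simp

/-- By monotonicity the level set is an initial segment of `ℕ`, finite because `u` is unbounded.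
Hence sums over it are sums over `Finset.range (levelCount u r)`. -/
theorem lt_levelCount (hm : Monotone u) (ht : Tendsto u atTop atTop) (r : ℝ) (k : ℕ) :
    k < levelCount u r ↔ u k ≤ r := by
  have hex : ∃ k, r < u k := (ht.eventually_gt_atTop r).exists
  classical
  have hset : ∀ k, u k ≤ r ↔ k < Nat.find hex := by
    intro k
    rw [Nat.lt_find_iff]
    exact ⟨fun h m hmk => not_lt.2 ((hm hmk).trans h), fun h => not_lt.1 (h k le_rfl)⟩
  have : levelCount u r = Nat.find hex := by
    rw [levelCount, show {k : ℕ | u k ≤ r} = Set.Iio (Nat.find hex) from Set.ext hset]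
    simp
  rw [this, hset]

theorem levelCount_mono (hm : Monotone u) (ht : Tendsto u atTop atTop) :
    Monotone (levelCount u) := by
  intro r r' h
  by_contra! hlt
  exact lt_irrefl _ ((lt_levelCount hm ht r' _).2 (((lt_levelCount hm ht r _).1 hlt).trans h))

theorem tendsto_levelCount_atTop (hm : Monotone u) (ht : Tendsto u atTop atTop) :
    Tendsto (levelCount u) atTop atTop := by
  refine tendsto_atTop.2 fun n => ?_
  filter_upwards [eventually_ge_atTop (u n)] with r hr
  exact ((lt_levelCount hm ht r n).2 hr).le

/-- With `N = levelCount u r` one has `u (N - 1) ≤ r < u N`, so `N / r` lies between `N / u N` and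
`N / u (N - 1)`, both tending to `c⁻¹`. -/
theorem tendsto_levelCount_div (hm : Monotone u) (hc : 0 < c)
    (hu : Tendsto (fun k : ℕ => u k / k) atTop (𝓝 c)) :
    Tendsto (fun r => (levelCount u r : ℝ) / r) atTop (𝓝 c⁻¹) := by
  have ht := tendsto_atTop_of_div hc hu
  have hP := tendsto_levelCount_atTop hm ht
  have h1 := (hu.comp hP).inv₀ hc.ne'
  have h2 : Tendsto (fun k : ℕ => u k / (k + 1 : ℕ)) atTop (𝓝 c) := by
    have := hu.mul (tendsto_natCast_div_add_atTop (1 : ℝ))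
    rw [mul_one] at this
    refine this.congr' ?_
    filter_upwards [eventually_gt_atTop 0] with k hk
    have hk' : (k : ℝ) ≠ 0 := by exact_mod_cast hk.ne'
    push_cast
    field_simp
  have h3 := (h2.comp ((tendsto_sub_atTop_nat 1).comp hP)).inv₀ hc.ne'
  refine tendsto_of_tendsto_of_tendsto_of_le_of_le' h1 h3 ?_ ?_
  · filter_upwards [eventually_gt_atTop 0] with r hr
    have : r < u (levelCount u r) := by
      by_contra! h
      exact lt_irrefl _ ((lt_levelCount hm ht r _).2 h)
    simp only [Function.comp_apply, inv_div]
    gcongr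
  -- Positivity of `u` is not assumed here; exceeding `levelCount u 0` forces `u (N - 1) > 0`.
  · filter_upwards [hP.eventually_gt_atTop 0, hP.eventually_gt_atTop (levelCount u 0)] with r hr hr0
    have hlt : levelCount u r - 1 < levelCount u r := by omega
    have hle := (lt_levelCount hm ht r _).1 hlt
    have hpos : 0 < u (levelCount u r - 1) := by
      by_contra! h
      have := (lt_levelCount hm ht 0 _).2 h
      omega
    simp only [Function.comp_apply, inv_div]
    rw [Nat.sub_add_cancel hr]
    gcongr

theorem tendsto_sum_levelCount (hm : Monotone u) (hc : 0 < c)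
    (hu : Tendsto (fun k : ℕ => u k / k) atTop (𝓝 c)) (j : ℕ) :
    Tendsto (fun r => (∑ k ∈ Finset.range (levelCount u r), Real.log (u k) ^ j / u k) /
      Real.log r ^ (j + 1)) atTop (𝓝 (c⁻¹ / (j + 1))) := by
  have hP := tendsto_levelCount_atTop hm (tendsto_atTop_of_div hc hu)
  have h1 := (tendsto_sum_log_pow_div hc hu j).comp hP
  have h2 := (tendsto_log_div_log (inv_pos.2 hc) (tendsto_levelCount_div hm hc hu)
    tendsto_id).pow (j + 1)
  have h3 := h1.mul h2
  rw [one_pow, mul_one] at h3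
  refine h3.congr' ?_
  filter_upwards [(tendsto_log_natCast.comp hP).eventually_gt_atTop 0,
    Real.tendsto_log_atTop.eventually_gt_atTop 0] with r hr hr'
  simp only [Function.comp_apply] at hr ⊢
  rw [div_pow]
  field_simp

/-- This is `∫₀¹ (1 - x)^m dx`, obtained from `(m+1) C(m,j) = (j+1) C(m+1,j+1)` and the vanishing
alternating sum of row `m + 1`. -/
theorem sum_choose_neg_one_pow_div (m : ℕ) :
    ∑ j ∈ Finset.range (m + 1), (m.choose j : ℝ) * (-1) ^ j / (j + 1) = 1 / (m + 1) := by
  have h1 := (Int.alternating_sum_range_choose (n := m + 1))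
  rw [if_neg (Nat.succ_ne_zero m), Finset.sum_range_succ'] at h1
  have h2 : ∑ j ∈ Finset.range (m + 1), (-1 : ℝ) ^ (j + 1) * ((m + 1).choose (j + 1) : ℝ) + 1 = 0 := by
    have := congrArg (Int.cast : ℤ → ℝ) h1
    push_cast at this
    simpa using this
  rw [eq_div_iff (by positivity), Finset.sum_mul]
  have h3 : ∀ j ∈ Finset.range (m + 1), (m.choose j : ℝ) * (-1) ^ j / (j + 1) * (m + 1) =
      -((-1 : ℝ) ^ (j + 1) * ((m + 1).choose (j + 1) : ℝ)) := by
    intro j _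
    have := congrArg (Nat.cast : ℕ → ℝ) (Nat.add_one_mul_choose_eq m j)
    push_cast at this
    rw [div_mul_eq_mul_div, div_eq_iff (by positivity), pow_succ]
    linear_combination (-1) ^ j * this
  rw [Finset.sum_congr rfl h3, Finset.sum_neg_distrib]
  linarith

/-- Expand `(log r - log (u k))^m` binomially. All terms have the same order `(log r)^(m+1)`, so the
limit is an alternating sum, evaluated by `sum_choose_neg_one_pow_div`. -/
theorem tendsto_sum_log_div_pow (hm : Monotone u) (hpos : ∀ k, 0 < u k) (hc : 0 < c)
    (hu : Tendsto (fun k : ℕ => u k / k) atTop (𝓝 c)) (m : ℕ) :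
    Tendsto (fun r => (∑ k ∈ Finset.range (levelCount u r), Real.log (r / u k) ^ m / u k) /
      Real.log r ^ (m + 1)) atTop (𝓝 (c⁻¹ / (m + 1))) := by
  have h1 := tendsto_finsetSum (Finset.range (m + 1)) fun j _ =>
    (tendsto_sum_levelCount hm hc hu j).const_mul ((m.choose j : ℝ) * (-1) ^ j)
  have h2 : ∑ j ∈ Finset.range (m + 1), (m.choose j : ℝ) * (-1) ^ j * (c⁻¹ / (j + 1)) =
      c⁻¹ / (m + 1) := by
    rw [div_eq_mul_one_div, ← sum_choose_neg_one_pow_div, Finset.mul_sum]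
    exact Finset.sum_congr rfl fun j _ => by ring
  rw [h2] at h1
  refine h1.congr' ?_
  filter_upwards [Real.tendsto_log_atTop.eventually_gt_atTop 0, eventually_gt_atTop 0] with r hl hr
  rw [eq_div_iff (by positivity), Finset.sum_mul]
  have h3 : ∀ j ∈ Finset.range (m + 1), (m.choose j : ℝ) * (-1) ^ j *
      ((∑ k ∈ Finset.range (levelCount u r), Real.log (u k) ^ j / u k) / Real.log r ^ (j + 1)) *
      Real.log r ^ (m + 1) = ∑ k ∈ Finset.range (levelCount u r),
        (-Real.log (u k)) ^ j * Real.log r ^ (m - j) * (m.choose j : ℝ) / u k := by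
    intro j hj
    have hj' : j ≤ m := Nat.lt_succ_iff.1 (Finset.mem_range.1 hj)
    rw [show m + 1 = (j + 1) + (m - j) by omega, pow_add, mul_div_assoc', div_mul_eq_mul_div,
      div_eq_iff (by positivity), Finset.mul_sum, Finset.sum_mul, Finset.sum_mul]
    refine Finset.sum_congr rfl fun k _ => ?_
    rw [neg_pow]
    ring
  rw [Finset.sum_congr rfl h3, Finset.sum_comm]
  refine Finset.sum_congr rfl fun k _ => ?_
  rw [← Finset.sum_div, ← add_pow, Real.log_div hr.ne' (hpos k).ne']
  ring

end Counting

/-! ### Lattice points in the weighted hyperbolic cross -/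

section LatticeCount

/-- The number of `k : Fin d → ℤ` with `∏ j, u |k j| ≤ r`, computed recursively
(see `exists_finset_card_eq_latticeCount`). -/
noncomputable def latticeCount (u : ℕ → ℝ) : ℕ → ℝ → ℝ
  | 0, r => if 1 ≤ r then 1 else 0
  | d + 1, r => 2 * ∑ k ∈ Finset.range (levelCount u r), latticeCount u d (r / u k) -
      latticeCount u d r

variable {u : ℕ → ℝ} {c : ℝ}

theorem levelCount_eq_zero (hm : Monotone u) (ht : Tendsto u atTop atTop) (h0 : u 0 = 1) {r : ℝ}
    (hr : r < 1) : levelCount u r = 0 := by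
  by_contra h
  have := (lt_levelCount hm ht r 0).1 (Nat.pos_of_ne_zero h)
  linarith

theorem levelCount_pos (hm : Monotone u) (ht : Tendsto u atTop atTop) (h0 : u 0 = 1) {r : ℝ}
    (hr : 1 ≤ r) : 0 < levelCount u r :=
  (lt_levelCount hm ht r 0).2 (h0.trans_le hr)

theorem latticeCount_eq_zero (hm : Monotone u) (ht : Tendsto u atTop atTop) (h0 : u 0 = 1)
    (d : ℕ) {r : ℝ} (hr : r < 1) : latticeCount u d r = 0 := by
  induction d with
  | zero => simp [latticeCount, hr]
  | succ d ih => simp [latticeCount, levelCount_eq_zero hm ht h0 hr, ih]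

/-- Needed because the recursion evaluates the count at `r / u k`, which need not be large, where
the asymptotic formula says nothing. -/
theorem exists_abs_latticeCount_le (hm : Monotone u) (ht : Tendsto u atTop atTop) (h0 : u 0 = 1)
    (d : ℕ) (x₀ : ℝ) : ∃ B, ∀ x ≤ x₀, |latticeCount u d x| ≤ B := by
  induction d with
  | zero =>
    refine ⟨1, fun x _ => ?_⟩
    rw [latticeCount]
    split_ifs <;> simp
  | succ d ih =>
    obtain ⟨B, hB⟩ := ih
    refine ⟨2 * (levelCount u x₀ * B) + B, fun x hx => ?_⟩
    have hB0 : 0 ≤ B := (abs_nonneg _).trans (hB x hx)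
    rw [latticeCount]
    refine (abs_sub _ _).trans (add_le_add ?_ (hB x hx))
    rw [abs_mul, abs_two]
    refine mul_le_mul_of_nonneg_left ?_ zero_le_two
    refine (Finset.abs_sum_le_sum_abs _ _).trans ?_
    have h1 : ∀ k ∈ Finset.range (levelCount u x), |latticeCount u d (x / u k)| ≤ B := by
      intro k hk
      have hk1 : 1 ≤ u k := h0 ▸ hm (Nat.zero_le k)
      have hk2 := (lt_levelCount hm ht x k).1 (Finset.mem_range.1 hk)
      exact hB _ ((div_le_self (by linarith) hk1).trans hx)
    refine (Finset.sum_le_sum h1).trans ?_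
    rw [Finset.sum_const, Finset.card_range, nsmul_eq_mul]
    have := levelCount_mono hm ht hx
    gcongr

/-- Summing `f (r / u k)` with `f x ~ A x (log x)^m` and `u k ~ c k`. -/
theorem tendsto_sum_comp_div (hm : Monotone u) (h0 : u 0 = 1) (hc : 0 < c)
    (hu : Tendsto (fun k : ℕ => u k / k) atTop (𝓝 c)) {f : ℝ → ℝ} {A : ℝ} {m : ℕ}
    (hbdd : ∀ x₀, ∃ B, ∀ x ≤ x₀, |f x| ≤ B)
    (hf : Tendsto (fun x => f x / (x * Real.log x ^ m)) atTop (𝓝 A)) :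
    Tendsto (fun r => (∑ k ∈ Finset.range (levelCount u r), f (r / u k)) /
      (r * Real.log r ^ (m + 1))) atTop (𝓝 (A * (c⁻¹ / (m + 1)))) := by
  have ht := tendsto_atTop_of_div hc hu
  have hu1 : ∀ k, 1 ≤ u k := fun k => h0 ▸ hm (Nat.zero_le k)
  have hupos : ∀ k, 0 < u k := fun k => one_pos.trans_le (hu1 k)
  have hS := tendsto_sum_log_div_pow hm hupos hc hu m
  set S : ℝ → ℝ := fun r => ∑ k ∈ Finset.range (levelCount u r), Real.log (r / u k) ^ m / u k
    with hSdef
  -- The additive constant absorbs the bounded range of `x`, so the estimate applies to every `r / u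
  -- k` in the sum.
  have herr : ∀ ε > 0, ∃ C, ∀ x ≥ 1, |f x - A * (x * Real.log x ^ m)| ≤
      ε * (x * Real.log x ^ m) + C := by
    intro ε hε
    obtain ⟨x₀, hx₀⟩ := eventually_atTop.1
      ((Metric.tendsto_nhds.1 hf ε hε).and (eventually_gt_atTop 1))
    obtain ⟨B, hB⟩ := hbdd x₀
    have hx1 : 1 < x₀ := (hx₀ x₀ le_rfl).2
    have hl0 := Real.log_pos hx1
    have hB0 : 0 ≤ B := (abs_nonneg _).trans (hB x₀ le_rfl)
    refine ⟨B + |A| * (x₀ * Real.log x₀ ^ m), fun x hx => ?_⟩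
    have hl := Real.log_nonneg hx
    rcases le_total x₀ x with h | h
    · obtain ⟨h1, h2⟩ := hx₀ x h
      have hpos : 0 < x * Real.log x ^ m := by
        have := Real.log_pos h2
        positivity
      rw [Real.dist_eq] at h1
      have h3 : f x - A * (x * Real.log x ^ m) =
          (f x / (x * Real.log x ^ m) - A) * (x * Real.log x ^ m) := by
        rw [sub_mul, div_mul_cancel₀ _ hpos.ne']
      rw [h3, abs_mul, abs_of_pos hpos]
      have h4 : 0 ≤ B + |A| * (x₀ * Real.log x₀ ^ m) := by positivity
      nlinarith [mul_le_mul_of_nonneg_right h1.le hpos.le]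
    · have h1 : |f x - A * (x * Real.log x ^ m)| ≤ B + |A| * (x₀ * Real.log x₀ ^ m) := by
        refine (abs_sub _ _).trans (add_le_add (hB x h) ?_)
        rw [abs_mul, abs_of_nonneg (a := x * Real.log x ^ m) (by positivity)]
        have := Real.log_le_log (by linarith) h
        gcongr
      have h2 : 0 ≤ ε * (x * Real.log x ^ m) := by positivity
      linarith
  have hdiff : Tendsto (fun r => (∑ k ∈ Finset.range (levelCount u r), f (r / u k)) /
      (r * Real.log r ^ (m + 1)) - A * (S r / Real.log r ^ (m + 1))) atTop (𝓝 0) := by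
    rw [Metric.tendsto_nhds]
    intro δ hδ
    have hκ : 0 < c⁻¹ / ((m : ℝ) + 1) := by positivity
    set κ := c⁻¹ / ((m : ℝ) + 1) with hκdef
    -- As `S r / (log r)^(m+1) → κ`, this choice makes the relative error contribute `δ / 2` in the
    -- limit. The constants add up to `C * levelCount u r`, which is `O(r)` and disappears after
    -- division.
    obtain ⟨C, hC⟩ := herr (δ / (2 * κ)) (by positivity)
    have h1 : Tendsto (fun r => δ / (2 * κ) * (S r / Real.log r ^ (m + 1)) +
        C * ((levelCount u r / r) / Real.log r ^ (m + 1))) atTop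
        (𝓝 (δ / (2 * κ) * κ + C * 0)) :=
      (hS.const_mul _).add (((tendsto_levelCount_div hm hc hu).div_atTop
        ((tendsto_pow_atTop (Nat.succ_ne_zero m)).comp Real.tendsto_log_atTop)).const_mul _)
    have h2 : δ / (2 * κ) * κ + C * 0 < δ := by
      field_simp
      linarith
    filter_upwards [h1.eventually_lt_const h2, eventually_gt_atTop 1] with r hr hr1
    have hl := Real.log_pos hr1
    have hr0 : 0 < r := by linarith
    rw [Real.dist_eq, sub_zero]
    refine lt_of_le_of_lt ?_ hr
    have hden : 0 < r * Real.log r ^ (m + 1) := by positivity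
    have h3 : ∀ k, r * (Real.log (r / u k) ^ m / u k) = r / u k * Real.log (r / u k) ^ m :=
      fun k => by ring
    have h4 : (∑ k ∈ Finset.range (levelCount u r), f (r / u k)) /
        (r * Real.log r ^ (m + 1)) - A * (S r / Real.log r ^ (m + 1)) =
        (∑ k ∈ Finset.range (levelCount u r),
          (f (r / u k) - A * (r / u k * Real.log (r / u k) ^ m))) /
          (r * Real.log r ^ (m + 1)) := by
      rw [Finset.sum_sub_distrib, ← Finset.mul_sum, ← Finset.sum_congr rfl fun k _ => h3 k,
        ← Finset.mul_sum, sub_div]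
      congr 1
      change _ = A * (r * S r) / _
      field_simp
    have h5 : δ / (2 * κ) * (S r / Real.log r ^ (m + 1)) +
        C * ((levelCount u r / r) / Real.log r ^ (m + 1)) =
        (∑ k ∈ Finset.range (levelCount u r),
          (δ / (2 * κ) * (r / u k * Real.log (r / u k) ^ m) + C)) /
          (r * Real.log r ^ (m + 1)) := by
      rw [Finset.sum_add_distrib, ← Finset.mul_sum, ← Finset.sum_congr rfl fun k _ => h3 k,
        ← Finset.mul_sum, Finset.sum_const, Finset.card_range, nsmul_eq_mul, add_div]
      change _ = δ / (2 * κ) * (r * S r) / _ + _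
      congr 1
      · field_simp
      · field_simp
    rw [h4, h5, abs_div, abs_of_pos hden]
    gcongr
    refine (Finset.abs_sum_le_sum_abs _ _).trans (Finset.sum_le_sum fun k hk => hC _ ?_)
    rw [ge_iff_le, one_le_div (hupos k)]
    exact (lt_levelCount hm ht r k).1 (Finset.mem_range.1 hk)
  have := hdiff.add (hS.const_mul A)
  rw [zero_add] at this
  exact this.congr fun r => sub_add_cancel _ _

/-- Each further coordinate multiplies the constant by `2 / (c (m + 1))`, the `2` coming from the
two signs. The correction for counting zero twice is of lower order. -/
theorem tendsto_latticeCount (hm : Monotone u) (h0 : u 0 = 1) (hc : 0 < c)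
    (hu : Tendsto (fun k : ℕ => u k / k) atTop (𝓝 c)) (m : ℕ) :
    Tendsto (fun r => latticeCount u (m + 1) r / (r * Real.log r ^ m)) atTop
      (𝓝 ((2 / c) ^ (m + 1) / (m.factorial : ℝ))) := by
  have ht := tendsto_atTop_of_div hc hu
  have hu1 : ∀ k, 1 ≤ u k := fun k => h0 ▸ hm (Nat.zero_le k)
  induction m with
  | zero =>
    have h1 := ((tendsto_levelCount_div hm hc hu).const_mul 2).sub
      (tendsto_inv_atTop_zero (𝕜 := ℝ))
    have h2 : (2 / c) ^ (0 + 1) / ((Nat.factorial 0 : ℕ) : ℝ) = 2 * c⁻¹ - 0 := by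
      simp [div_eq_mul_inv]
    rw [h2]
    refine h1.congr' ?_
    filter_upwards [eventually_ge_atTop 1] with r hr
    have h3 : ∀ k ∈ Finset.range (levelCount u r), latticeCount u 0 (r / u k) = 1 := by
      intro k hk
      rw [latticeCount, if_pos]
      rw [one_le_div (one_pos.trans_le (hu1 k))]
      exact (lt_levelCount hm ht r k).1 (Finset.mem_range.1 hk)
    rw [latticeCount, Finset.sum_congr rfl h3, latticeCount, if_pos hr]
    simp
    ring
  | succ m ih =>
    have h1 := (tendsto_sum_comp_div hm h0 hc hu
      (exists_abs_latticeCount_le hm ht h0 (m + 1)) ih).const_mul 2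
    have h2 := h1.sub (ih.div_atTop Real.tendsto_log_atTop)
    have h3 : (2 / c) ^ (m + 1 + 1) / ((m + 1).factorial : ℝ) =
        2 * ((2 / c) ^ (m + 1) / (m.factorial : ℝ) * (c⁻¹ / (m + 1))) - 0 := by
      rw [Nat.factorial_succ, pow_succ]
      push_cast
      field_simp
      ring
    rw [h3]
    refine h2.congr' ?_
    filter_upwards [eventually_gt_atTop 1] with r hr
    rw [show latticeCount u (m + 1 + 1) r = 2 * ∑ k ∈ Finset.range (levelCount u r),
      latticeCount u (m + 1) (r / u k) - latticeCount u (m + 1) r from rfl, sub_div,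
      mul_div_assoc, div_div, mul_assoc r, ← pow_succ]

theorem sum_Ioo_natAbs (h : ℕ → ℝ) {P : ℕ} (hP : 0 < P) :
    ∑ k ∈ Finset.Ioo (-(P : ℤ)) P, h k.natAbs = 2 * ∑ k ∈ Finset.range P, h k - h 0 := by
  induction P, hP using Nat.le_induction with
  | base =>
    have : Finset.Ioo (-((0 + 1 : ℕ) : ℤ)) ((0 + 1 : ℕ) : ℤ) = {0} := by decide
    rw [this]
    simp
    ring
  | succ P hP ih =>
    have : Finset.Ioo (-((P + 1 : ℕ) : ℤ)) ((P + 1 : ℕ) : ℤ) =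
        insert (P : ℤ) (insert (-(P : ℤ)) (Finset.Ioo (-(P : ℤ)) P)) := by
      ext k
      simp only [Finset.mem_Ioo, Finset.mem_insert]
      omega
    rw [this, Finset.sum_insert, Finset.sum_insert, ih, Finset.sum_range_succ, Int.natAbs_neg,
      Int.natAbs_natCast]
    · ring
    · simp
    · simp only [Finset.mem_Ioo, Finset.mem_insert]
      omega

/-- Slice by the first coordinate. Since all factors are at least `1`, it satisfies `u |k 0| ≤ r`
automatically, and the tail lies in the cross of level `r / u |k 0|`. -/
theorem exists_finset_card_eq_latticeCount (hm : Monotone u) (h0 : u 0 = 1)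
    (ht : Tendsto u atTop atTop) (d : ℕ) (r : ℝ) :
    ∃ F : Finset (Fin d → ℤ), (∀ k, k ∈ F ↔ ∏ j, u (k j).natAbs ≤ r) ∧
      (F.card : ℝ) = latticeCount u d r := by
  have hu1 : ∀ k, 1 ≤ u k := fun k => h0 ▸ hm (Nat.zero_le k)
  induction d generalizing r with
  | zero =>
    by_cases hr : 1 ≤ r
    · exact ⟨Finset.univ, fun k => iff_of_true (Finset.mem_univ k) (by simpa using hr), by simp [latticeCount, hr]⟩
    · exact ⟨∅, by simpa using hr, by simp [latticeCount, hr]⟩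
  | succ d ih =>
    choose F hF hcard using ih
    let e : (Σ _ : ℤ, Fin d → ℤ) ↪ (Fin (d + 1) → ℤ) :=
      ⟨fun p => Fin.cons p.1 p.2, by
        rintro ⟨a, k⟩ ⟨b, l⟩ h
        obtain ⟨rfl, rfl⟩ := Fin.cons_injective2 h
        rfl⟩
    let P := levelCount u r
    refine ⟨((Finset.Ioo (-(P : ℤ)) P).sigma fun k => F (r / u k.natAbs)).map e, fun k => ?_, ?_⟩
    · have h1 : k ∈ ((Finset.Ioo (-(P : ℤ)) P).sigma fun k => F (r / u k.natAbs)).map e ↔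
          k 0 ∈ Finset.Ioo (-(P : ℤ)) P ∧ Fin.tail k ∈ F (r / u (k 0).natAbs) := by
        rw [Finset.mem_map]
        constructor
        · rintro ⟨p, hp, rfl⟩
          exact Finset.mem_sigma.1 hp
        · intro h
          exact ⟨⟨k 0, Fin.tail k⟩, Finset.mem_sigma.2 h, Fin.cons_self_tail k⟩
      have h2 : k 0 ∈ Finset.Ioo (-(P : ℤ)) P ↔ u (k 0).natAbs ≤ r := by
        rw [← lt_levelCount hm ht r, Finset.mem_Ioo]
        simp only [P]
        omega
      have hpos := one_pos.trans_le (hu1 (k 0).natAbs)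
      rw [h1, h2, hF, le_div_iff₀ hpos, Fin.prod_univ_succ, mul_comm]
      refine ⟨fun h => h.2, fun h => ⟨?_, h⟩⟩
      refine (le_mul_of_one_le_right hpos.le ?_).trans h
      exact (Finset.prod_const_one (s := Finset.univ)).ge.trans
        (Finset.prod_le_prod (fun _ _ => zero_le_one) fun j _ => hu1 _)
    · rw [Finset.card_map, Finset.card_sigma]
      push_cast
      simp only [hcard]
      -- `sum_Ioo_natAbs` needs a nonempty interval, that is `r ≥ 1`; below that both counts are
      -- `0`.
      rcases lt_or_ge r 1 with hr | hr
      · have hP : P = 0 := levelCount_eq_zero hm ht h0 hr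
        rw [latticeCount_eq_zero hm ht h0 _ hr, hP]
        simp
      · rw [sum_Ioo_natAbs (fun k => latticeCount u d (r / u k)) (levelCount_pos hm ht h0 hr), h0,
          div_one, latticeCount]

end LatticeCount

/-! ### From lattice counts to approximation numbers -/

section Main

variable {u : ℕ → ℝ} {c : ℝ}

/-- For `x = t n / (log n)^m` one has `log x ~ log n`, because `log log n = o(log n)`. Hence `x (log
x)^m ~ t n`. -/
theorem tendsto_latticeCount_comp (hm : Monotone u) (h0 : u 0 = 1) (hc : 0 < c)
    (hu : Tendsto (fun k : ℕ => u k / k) atTop (𝓝 c)) (m : ℕ) {t : ℝ} (ht : 0 < t) :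
    Tendsto (fun n : ℕ => latticeCount u (m + 1) (t * (n / Real.log n ^ m)) / n) atTop
      (𝓝 ((2 / c) ^ (m + 1) / (m.factorial : ℝ) * t)) := by
  have hlog : Tendsto (fun n : ℕ => Real.log (t * (n / Real.log n ^ m)) / Real.log n) atTop
      (𝓝 1) := by
    have h1 : Tendsto (fun n : ℕ => Real.log (Real.log n) / Real.log n) atTop (𝓝 0) :=
      (Real.isLittleO_log_id_atTop.tendsto_div_nhds_zero).comp tendsto_log_natCast
    have h2 := ((tendsto_log_natCast.const_div_atTop (Real.log t)).add_const 1).sub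
      (h1.const_mul (m : ℝ))
    rw [zero_add, mul_zero, sub_zero] at h2
    refine h2.congr' ?_
    filter_upwards [tendsto_log_natCast.eventually_gt_atTop 0, eventually_gt_atTop 0] with n hl hn
    have hn' : (0 : ℝ) < n := by exact_mod_cast hn
    rw [Real.log_mul ht.ne' (by positivity), Real.log_div hn'.ne' (by positivity), Real.log_pow]
    field_simp
    ring
  -- Exponentiate `log x = (log x / log n) * log n`, which tends to infinity by `hlog`.
  have htop : Tendsto (fun n : ℕ => t * ((n : ℝ) / Real.log n ^ m)) atTop atTop := by
    have h1 := Real.tendsto_exp_atTop.comp (hlog.pos_mul_atTop one_pos tendsto_log_natCast)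
    refine h1.congr' ?_
    filter_upwards [tendsto_log_natCast.eventually_gt_atTop 0, eventually_gt_atTop 0] with n hl hn
    have hn' : (0 : ℝ) < n := by exact_mod_cast hn
    rw [Function.comp_apply, div_mul_cancel₀ _ hl.ne', Real.exp_log (by positivity)]
  have h2 := (((tendsto_latticeCount hm h0 hc hu m).comp htop).mul (hlog.pow m)).mul_const t
  rw [one_pow, mul_one] at h2
  refine h2.congr' ?_
  filter_upwards [tendsto_log_natCast.eventually_gt_atTop 0, eventually_gt_atTop 0,
    (Real.tendsto_log_atTop.comp htop).eventually_gt_atTop 0] with n hl hn hlt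
  have hn' : (0 : ℝ) < n := by exact_mod_cast hn
  simp only [Function.comp_apply] at hlt ⊢
  rw [div_pow]
  generalize latticeCount u (m + 1) (t * (n / Real.log n ^ m)) = M
  generalize Real.log (t * (n / Real.log n ^ m)) = l at hlt
  field_simp

/-- Taking `s`-th roots turns level sets of the product weight into those counted by `latticeCount`.
-/
theorem FourierWeight.prodVal_le_iff (w : FourierWeight) {s : ℝ} (hs : 0 < s) {d : ℕ}
    (k : Fin d → ℤ) {r : ℝ} (hr : 0 ≤ r) :
    w.prodVal k ≤ r ^ s ↔ ∏ j, w.toFun (k j).natAbs ^ (1 / s) ≤ r := by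
  have hw : ∀ j, 0 ≤ w.toFun (k j).natAbs := fun j => zero_le_one.trans (w.one_le_val (k j))
  rw [Real.finsetProd_rpow _ _ fun j _ => hw j, one_div,
    Real.rpow_inv_le_iff_of_pos (Finset.prod_nonneg fun j _ => hw j) hr hs]
  rfl

theorem tendsto_approxNumber_mixedEmbedding (T : TorusData) {d : ℕ} (hd : 1 ≤ d)
    (w : FourierWeight) {s : ℝ} (hs : 0 < s) (hc : 0 < c)
    (hw : Tendsto (fun k : ℕ => w.toFun k ^ (1 / s) / k) atTop (𝓝 c)) :
    Tendsto (fun n : ℕ => approxNumber (T.mixedEmbedding d w) n * (n : ℝ) ^ s *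
      Real.log n ^ (-(s * ((d : ℝ) - 1)))) atTop
      (𝓝 (((2 / c) ^ d / ((d - 1).factorial : ℝ)) ^ s)) := by
  obtain ⟨m, rfl⟩ : ∃ m, d = m + 1 := ⟨d - 1, by omega⟩
  rw [Nat.add_sub_cancel]
  set A : ℝ := (2 / c) ^ (m + 1) / (m.factorial : ℝ) with hA
  have hApos : 0 < A := by positivity
  let u : ℕ → ℝ := fun k => w.toFun k ^ (1 / s)
  have hw1 : ∀ k, 1 ≤ w.toFun k := fun k => w.zero ▸ w.monotone (Nat.zero_le k)
  have hm : Monotone u := fun k l h =>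
    Real.rpow_le_rpow (zero_le_one.trans (hw1 k)) (w.monotone h) (by positivity)
  have h0 : u 0 = 1 := by simp [u, w.zero]
  have hcount := fun r => exists_finset_card_eq_latticeCount hm h0 (tendsto_atTop_of_div hc hw)
    (m + 1) r
  -- The normalising factor of the theorem is eventually `φ n ^ s`. Taking level `z⁻¹ * φ n` makes
  -- the count about `(A / z) n`: below `n` when `z > A`, above `n` when `z < A`.
  let φ : ℕ → ℝ := fun n => n / Real.log n ^ m
  have hφ : ∀ᶠ n in atTop, 0 < φ n := by
    filter_upwards [tendsto_log_natCast.eventually_gt_atTop 0, eventually_gt_atTop 0] with n hl hn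
    have hn' : (0 : ℝ) < n := by exact_mod_cast hn
    positivity
  suffices h : Tendsto (fun n : ℕ => approxNumber (T.mixedEmbedding (m + 1) w) n * φ n ^ s) atTop
      (𝓝 (A ^ s)) by
    refine h.congr' ?_
    filter_upwards [tendsto_log_natCast.eventually_gt_atTop 0] with n hl
    rw [mul_assoc, Real.div_rpow (Nat.cast_nonneg n) (by positivity), ← Real.rpow_natCast,
      ← Real.rpow_mul hl.le, Real.rpow_neg hl.le, div_eq_mul_inv]
    push_cast
    ring_nf
  have hlim := fun t (ht : 0 < t) => tendsto_latticeCount_comp hm h0 hc hw m ht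
  have hupper : ∀ z, A < z → ∀ᶠ n in atTop,
      approxNumber (T.mixedEmbedding (m + 1) w) n * φ n ^ s ≤ z ^ s := by
    intro z hz
    have hz0 : 0 < z := hApos.trans hz
    have hAz : A * z⁻¹ < 1 := by rwa [← div_eq_mul_inv, div_lt_one hz0]
    filter_upwards [(hlim z⁻¹ (inv_pos.2 hz0)).eventually_lt_const hAz, hφ,
      eventually_gt_atTop 0] with n hn hφn hn0
    have hn' : (0 : ℝ) < n := by exact_mod_cast hn0
    obtain ⟨F, hF, hcard⟩ := hcount (z⁻¹ * φ n)
    have hr : 0 < z⁻¹ * φ n := by positivity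
    have hlt : F.card < n := by
      rw [div_lt_one hn'] at hn
      exact_mod_cast hcard.trans_lt hn
    have h1 := approxNumber_embedding_le (T.basis (m + 1)) w.prodVal w.one_le_prodVal
      (F := F) (R := (z⁻¹ * φ n) ^ s) (by positivity) (fun k hk => by
        rw [hF, ← w.prodVal_le_iff hs k hr.le] at hk
        exact (not_le.1 hk).le) hlt
    calc approxNumber (T.mixedEmbedding (m + 1) w) n * φ n ^ s
        ≤ ((z⁻¹ * φ n) ^ s)⁻¹ * φ n ^ s := by gcongr; exact h1
      _ = z ^ s := by
        rw [Real.mul_rpow (by positivity) hφn.le, Real.inv_rpow hz0.le]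
        have : φ n ^ s ≠ 0 := by positivity
        field_simp
  have hlower : ∀ z, 0 < z → z < A → ∀ᶠ n in atTop,
      z ^ s ≤ approxNumber (T.mixedEmbedding (m + 1) w) n * φ n ^ s := by
    intro z hz0 hz
    have hAz : 1 < A * z⁻¹ := by rwa [← div_eq_mul_inv, one_lt_div hz0]
    filter_upwards [(hlim z⁻¹ (inv_pos.2 hz0)).eventually_const_lt hAz, hφ,
      eventually_gt_atTop 0] with n hn hφn hn0
    have hn' : (0 : ℝ) < n := by exact_mod_cast hn0
    obtain ⟨F, hF, hcard⟩ := hcount (z⁻¹ * φ n)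
    have hr : 0 < z⁻¹ * φ n := by positivity
    have hlt : n < F.card := by
      rw [one_lt_div hn'] at hn
      exact_mod_cast hn.trans_eq hcard.symm
    have h1 := le_approxNumber_embedding (T.basis (m + 1)) w.prodVal w.one_le_prodVal
      (F := F) (R := (z⁻¹ * φ n) ^ s) (by positivity) (fun k hk => by
        rwa [hF, ← w.prodVal_le_iff hs k hr.le] at hk) hn0 hlt.le
    calc z ^ s = ((z⁻¹ * φ n) ^ s)⁻¹ * φ n ^ s := by
          rw [Real.mul_rpow (by positivity) hφn.le, Real.inv_rpow hz0.le]
          have : φ n ^ s ≠ 0 := by positivity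
          field_simp
      _ ≤ approxNumber (T.mixedEmbedding (m + 1) w) n * φ n ^ s := by gcongr; exact h1
  have hcont : Tendsto (fun z : ℝ => z ^ s) (𝓝 A) (𝓝 (A ^ s)) :=
    (Real.continuousAt_rpow_const A s (Or.inl hApos.ne')).tendsto
  -- Continuity of `z ↦ z ^ s` at `A` supplies, for each `y` on either side of `A ^ s`, a `z` on the
  -- same side of `A` with `z ^ s` still between `y` and `A ^ s`.
  refine tendsto_order.2 ⟨fun y hy => ?_, fun y hy => ?_⟩
  · obtain ⟨z, hzy, hz0, hzA⟩ := (((hcont.eventually_const_lt hy).filter_mono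
      nhdsWithin_le_nhds).and (Ioo_mem_nhdsLT hApos)).exists
    exact (hlower z hz0 hzA).mono fun n hn => hzy.trans_le hn
  · obtain ⟨z, hzy, hzA⟩ := (((hcont.eventually_lt_const hy).filter_mono
      nhdsWithin_le_nhds).and self_mem_nhdsWithin : ∀ᶠ z in 𝓝[>] A, _).exists
    exact (hupper z hzA).mono fun n hn => hn.trans_lt hzy

/-! ### Asymptotics of the four weights -/

namespace TorusData

variable (T : TorusData) {γ : ℝ}

theorem freq_eq (hγ : 0 < γ) (k : ℕ) : T.freq γ k = 2 / (γ * ((T.b - T.a) / Real.pi)) * k := by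
  have h0 : 0 < T.b - T.a := Fact.out
  have := Real.pi_pos
  rw [freq, abs_of_nonneg (by positivity)]
  field_simp

theorem tendsto_freq (hγ : 0 < γ) : Tendsto (T.freq γ) atTop atTop := by
  have h0 : 0 < T.b - T.a := Fact.out
  have := Real.pi_pos
  rw [funext (T.freq_eq hγ)]
  exact tendsto_natCast_atTop_atTop.const_mul_atTop (by positivity)

/-- A weight asymptotic to the `s`-th power of the scaled frequency yields the limit constant. -/
theorem tendsto_approxNumber_of_tendsto_div_freq {d : ℕ} (hd : 1 ≤ d) (hγ : 0 < γ) {s : ℝ}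
    (hs : 0 < s) (w : FourierWeight)
    (hw : Tendsto (fun k : ℕ => w.toFun k / T.freq γ k ^ s) atTop (𝓝 1)) :
    Tendsto (fun n : ℕ => approxNumber (T.mixedEmbedding d w) n * (n : ℝ) ^ s *
      Real.log n ^ (-(s * ((d : ℝ) - 1)))) atTop
      (𝓝 (((γ * ((T.b - T.a) / Real.pi)) ^ d / ((d - 1).factorial : ℝ)) ^ s)) := by
  have h0 : 0 < T.b - T.a := Fact.out
  have hpi := Real.pi_pos
  -- The slope of the scaled frequency, arranged so that `2 / c` is the base in the limit constant.
  set c := 2 / (γ * ((T.b - T.a) / Real.pi)) with hc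
  have hc0 : 0 < c := by positivity
  have h2c : γ * ((T.b - T.a) / Real.pi) = 2 / c := by rw [hc]; field_simp
  rw [h2c]
  refine tendsto_approxNumber_mixedEmbedding T hd w hs hc0 ?_
  have h1 := (hw.rpow_const (p := 1 / s) (Or.inl one_ne_zero)).mul_const c
  rw [Real.one_rpow, one_mul] at h1
  refine h1.congr' ?_
  filter_upwards [(T.tendsto_freq hγ).eventually_gt_atTop 0, eventually_gt_atTop 0] with k hk hk0
  have hk' : (0 : ℝ) < k := by exact_mod_cast hk0
  have hwk : 0 ≤ w.toFun k := zero_le_one.trans (w.one_le_val k)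
  rw [Real.div_rpow hwk (by positivity), ← Real.rpow_mul hk.le, mul_one_div_cancel hs.ne',
    Real.rpow_one, T.freq_eq hγ, ← hc]
  field_simp

/-- A power of `g` is asymptotic to `x ^ s` if `g` is asymptotic to `x ^ p` and `s = p * q`. -/
theorem tendsto_rpow_div_rpow {x : ℕ → ℝ} (hx : Tendsto x atTop atTop) {g : ℕ → ℝ} {p q s : ℝ}
    (hg0 : ∀ k, 0 ≤ g k) (hg : Tendsto (fun k => g k / x k ^ p) atTop (𝓝 1)) (hs : p * q = s) :
    Tendsto (fun k => g k ^ q / x k ^ s) atTop (𝓝 1) := by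
  have h1 := hg.rpow_const (p := q) (Or.inl one_ne_zero)
  rw [Real.one_rpow] at h1
  refine h1.congr' ?_
  filter_upwards [hx.eventually_gt_atTop 0] with k hk
  rw [Real.div_rpow (hg0 k) (by positivity), ← Real.rpow_mul hk.le, hs]

theorem tendsto_one_add_rpow_div {x : ℕ → ℝ} (hx : Tendsto x atTop atTop) {p : ℝ} (hp : 0 < p) :
    Tendsto (fun k => (1 + x k ^ p) / x k ^ p) atTop (𝓝 1) := by
  have h1 := (((tendsto_rpow_atTop hp).comp hx).const_div_atTop 1).add_const 1
  rw [zero_add] at h1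
  refine h1.congr' ?_
  filter_upwards [hx.eventually_gt_atTop 0] with k hk
  have : x k ^ p ≠ 0 := by positivity
  rw [Function.comp_apply, add_div, div_self this]

/-- The top power `l = m` dominates the sum, so only this term affects the limit. -/
theorem tendsto_circWeight_div (hγ : 0 < γ) (m : ℕ) :
    Tendsto (fun k : ℕ => (T.circWeight m γ).toFun k / T.freq γ k ^ (m : ℝ)) atTop (𝓝 1) := by
  have hx := T.tendsto_freq hγ
  refine tendsto_rpow_div_rpow (p := 2 * m) hx
    (fun k => Finset.sum_nonneg fun l _ => pow_nonneg (T.freq_nonneg γ k) _) ?_ (by ring)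
  have h1 : Tendsto (fun k : ℕ => ∑ l ∈ Finset.range m,
      T.freq γ k ^ (2 * l) / T.freq γ k ^ (2 * m) + 1) atTop (𝓝 (∑ l ∈ Finset.range m, 0 + 1)) := by
    refine (tendsto_finsetSum _ fun l hl => ?_).add_const 1
    have := Finset.mem_range.1 hl
    exact (tendsto_pow_div_pow_atTop_zero (𝕜 := ℝ) (p := 2 * l) (q := 2 * m) (by omega)).comp hx
  rw [Finset.sum_const_zero, zero_add] at h1
  refine h1.congr' ?_
  filter_upwards [hx.eventually_gt_atTop 0] with k hk
  have h2 : T.freq γ k ^ (2 * (m : ℝ)) = T.freq γ k ^ (2 * m) := by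
    rw [← Real.rpow_natCast]
    push_cast
    rfl
  rw [h2, Finset.sum_range_succ, add_div, Finset.sum_div, div_self (by positivity)]

theorem tendsto_starWeight_div (hγ : 0 < γ) {s : ℝ} (hs : 0 < s) :
    Tendsto (fun k : ℕ => (T.starWeight s hs γ).toFun k / T.freq γ k ^ s) atTop (𝓝 1) := by
  have hx := T.tendsto_freq hγ
  exact tendsto_rpow_div_rpow hx
    (fun k => add_nonneg zero_le_one (Real.rpow_nonneg (T.freq_nonneg γ k) _))
    (tendsto_one_add_rpow_div hx (by positivity : 0 < 2 * s)) (by ring)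

theorem tendsto_plusWeight_div (hγ : 0 < γ) {s : ℝ} (hs : 0 < s) :
    Tendsto (fun k : ℕ => (T.plusWeight s hs γ).toFun k / T.freq γ k ^ s) atTop (𝓝 1) := by
  have hx := T.tendsto_freq hγ
  refine tendsto_rpow_div_rpow hx (p := 2) (fun k => by positivity) ?_ (by ring)
  simpa only [Real.rpow_two] using tendsto_one_add_rpow_div hx two_pos

theorem tendsto_sharpWeight_div (hγ : 0 < γ) {s : ℝ} (hs : 0 < s) :
    Tendsto (fun k : ℕ => (T.sharpWeight s hs γ).toFun k / T.freq γ k ^ s) atTop (𝓝 1) := by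
  have hx := T.tendsto_freq hγ
  refine tendsto_rpow_div_rpow hx (p := 1)
    (fun k => add_nonneg zero_le_one (T.freq_nonneg γ k)) ?_ (by ring)
  simpa only [Real.rpow_one] using tendsto_one_add_rpow_div hx one_pos

end TorusData

end Main

end TorusApprox

theorem mainTheorem9 (T : TorusApprox.TorusData) (d : ℕ) (hd : 1 ≤ d)
    (γ : ℝ) (hγ : 0 < γ) (s : ℝ) (hs : 0 < s) :
    (∀ m : ℕ, (m : ℝ) = s →
      Filter.Tendsto (fun n : ℕ => TorusApprox.approxNumber (T.mixedEmbedding d (T.circWeight m γ)) n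
          * (n : ℝ) ^ s * Real.log n ^ (-(s * ((d : ℝ) - 1))))
        Filter.atTop
        (nhds (((γ * ((T.b - T.a) / Real.pi)) ^ d / (Nat.factorial (d - 1) : ℝ)) ^ s))) ∧
    Filter.Tendsto (fun n : ℕ => TorusApprox.approxNumber (T.mixedEmbedding d (T.starWeight s hs γ)) n
        * (n : ℝ) ^ s * Real.log n ^ (-(s * ((d : ℝ) - 1))))
      Filter.atTop
      (nhds (((γ * ((T.b - T.a) / Real.pi)) ^ d / (Nat.factorial (d - 1) : ℝ)) ^ s)) ∧
    Filter.Tendsto (fun n : ℕ => TorusApprox.approxNumber (T.mixedEmbedding d (T.plusWeight s hs γ)) n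
        * (n : ℝ) ^ s * Real.log n ^ (-(s * ((d : ℝ) - 1))))
      Filter.atTop
      (nhds (((γ * ((T.b - T.a) / Real.pi)) ^ d / (Nat.factorial (d - 1) : ℝ)) ^ s)) ∧
    Filter.Tendsto (fun n : ℕ => TorusApprox.approxNumber (T.mixedEmbedding d (T.sharpWeight s hs γ)) n
        * (n : ℝ) ^ s * Real.log n ^ (-(s * ((d : ℝ) - 1))))
      Filter.atTop
      (nhds (((γ * ((T.b - T.a) / Real.pi)) ^ d / (Nat.factorial (d - 1) : ℝ)) ^ s)) := by
  refine ⟨?_, ?_, ?_, ?_⟩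
  · rintro m rfl
    exact T.tendsto_approxNumber_of_tendsto_div_freq hd hγ hs _ (T.tendsto_circWeight_div hγ m)
  · exact T.tendsto_approxNumber_of_tendsto_div_freq hd hγ hs _ (T.tendsto_starWeight_div hγ hs)
  · exact T.tendsto_approxNumber_of_tendsto_div_freq hd hγ hs _ (T.tendsto_plusWeight_div hγ hs)
  · exact T.tendsto_approxNumber_of_tendsto_div_freq hd hγ hs _ (T.tendsto_sharpWeight_div hγ hs)
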